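/- Let $D$ be a square-free positive integer, $C$ a positive divisor of $D$, and $M,L$ positive divisors of $D$ with $M\neq 1$ and $D\mid ML\mid DC$. Let $\psi$ be a quadratic Dirichlet character ($\psi^2=1$, the trivial character with $f=1$ being allowed) of conductor $f\mid\gcd(M,L)$, regarded as a primitive character modulo $f$ and extended by $0$ to integers not prime to $f$, and let $g(\psi)=\sum_{a\bmod f}\psi(a)e^{2\pi i a/f}$ be its Gauss sum. Put $B_2(t)=\langle t\rangle^2-\langle t\rangle+\frac16$ with $\langle t\rangle$ the fractional part of $t$. For $x=(x_1,x_2)\in(\mathbb{Q}/\mathbb{Z})^2$ and $z$ in the upper half-plane let $P_x(z)=\sum_{k\in\mathbb{Q}_{>0},\,k\equiv x_1 (1)}k\sum_{m\ge1}e^{2\pi i m(kz+x_2)}$, and let $\phi_x$ be Hecke's function $$\phi_x(z)=\tfrac12B_2(x_1)-P_x(z)-P_{-x}(z)-\delta(x)\frac{i}{2\pi(z-\overline z)},$$ where $\delta(x)=1$ if $x=0$ and $\delta(x)=0$ otherwise. Let $$E_\psi=-\frac1{2g(\psi)}\sum_{a\in(\mathbb{Z}/f)^\times}\ \sum_{b\in(\mathbb{Z}/f^2)^\times}\psi(a)\psi(b)\,\phi_{(a/f,\,b/f^2)},\qquad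 E_{M,L,\psi}=\Big[\frac Lf\Big]^-_\psi\circ\Big[\frac Mf\Big]^+_\psi(E_\psi),$$ where $[K]^{\pm}_\psi$ is the composite, over the primes $p\mid K$, of the commuting operators $[p]^+_\psi(h)(z)=h(z)-p\,\psi(p)h(pz)$, respectively $[p]^-_\psi(h)(z)=h(z)-\psi^{-1}(p)h(pz)$. For $\Gamma=\Gamma_0(DC)$ or $\Gamma_1(DC)$ let $\mathcal{R}_\Gamma(E)$ be the $\mathbb{Z}$-submodule of $\mathbb{C}$ generated by the numbers $2\pi i\,\mathrm{Res}_x(E\,dz)=e_x\cdot a_0(E;[x])$, for $x$ running over the cusps of $X_\Gamma$, where $e_x$ is the ramification index of $X_\Gamma$ (over the $j$-line) at $x$ and $a_0(E;[x])$ is the constant term of the Fourier expansion of $E$ at $x$. Finally, let $\varphi$ be Euler's function, $\mu(N)=\prod_{p\mid N}(p+1)$ (the product being over primes), and $$n_\psi=-\frac{f}{4g(\psi)}\sum_{a,b\in\mathbb{Z}/f\mathbb{Z}}\psi(a)\psi(b)B_2\Big(\frac{a+b}f\Big).$$ Then $E_{M,L,\psi}$ is a holomorphic modular form of weight two for $\Gamma_0(DC)$,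 and $$\mathcal{R}_{\Gamma_0(DC)}(E_{M,L,\psi})=n_\psi\cdot\frac{\varphi(\frac Df)\,\mu(\frac Lf)\,(\frac DM,C)}{L/f}\,\mathbb{Z},\qquad \mathcal{R}_{\Gamma_1(DC)}(E_{M,L,\psi})=n_\psi\cdot\frac{\varphi(\frac Df)\,\mu(\frac Lf)\,(\frac DM,C)\,f}{L/f}\,\mathbb{Z}.$$ -/

import Mathlib

open scoped UpperHalfPlane MatrixGroups ModularForm

noncomputable section

namespace QuadraticEisenstein

open UpperHalfPlane

/-! ### Hecke's weight two functions -/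

/-- The periodic second Bernoulli polynomial `⟨t⟩² - ⟨t⟩ + 1/6`. -/
def B2 (t : ℚ) : ℚ := Int.fract t ^ 2 - Int.fract t + 1 / 6

/-- `P_{(x₁,x₂)}(z) = ∑_{k ∈ ℚ, k > 0, k ≡ x₁ mod 1} k ∑_{m ≥ 1} e^{2πim(kz + x₂)}`. -/
def heckeP (x₁ x₂ : ℚ) (z : ℍ) : ℂ :=
  ∑' k : {k : ℚ // 0 < k ∧ ∃ n : ℤ, k = x₁ + n},
    (((k : ℚ) : ℂ) *
      ∑' m : ℕ+, Complex.exp (2 * Real.pi * Complex.I * (m : ℂ) * (((k : ℚ) : ℂ) * (z : ℂ) + (x₂ : ℂ))))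

/-- Hecke's function `φ_{(x₁,x₂)}`, depending only on `(x₁,x₂)` modulo `ℤ²`: it satisfies
`φ_x(z) + δ(x) · i/(2π(z - z̄)) = B₂(x₁)/2 - P_x(z) - P_{-x}(z)`,
where `δ(x)` is `1` if `x ∈ ℤ²` and `0` otherwise. -/
def heckePhi (x₁ x₂ : ℚ) (z : ℍ) : ℂ :=
  ((B2 x₁ : ℚ) : ℂ) / 2 - heckeP x₁ x₂ z - heckeP (-x₁) (-x₂) z
    - (if Int.fract x₁ = 0 ∧ Int.fract x₂ = 0 then
        Complex.I / (2 * Real.pi * ((z : ℂ) - (starRingEnd ℂ) (z : ℂ))) else 0)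

/-! ### The Eisenstein series -/

/-- The operator `γ_p : g ↦ g | diag(p, 1)` in weight two, i.e. `z ↦ p · g(pz)`. -/
def gammaOp (p : ℕ) (g : ℍ → ℂ) : ℍ → ℂ :=
  fun z => (p : ℂ) * g (ofComplex ((p : ℂ) * (z : ℂ)))

/-- `[p]⁺_ψ = 1 - ψ(p) γ_p`. -/
def opPlus {f : ℕ} (ψ : DirichletCharacter ℂ f) (p : ℕ) (g : ℍ → ℂ) : ℍ → ℂ :=
  fun z => g z - ψ (p : ZMod f) * gammaOp p g z

/-- `[p]⁻_ψ = 1 - p⁻¹ ψ⁻¹(p) γ_p`. -/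
def opMinus {f : ℕ} (ψ : DirichletCharacter ℂ f) (p : ℕ) (g : ℍ → ℂ) : ℍ → ℂ :=
  fun z => g z - (p : ℂ)⁻¹ * ψ⁻¹ (p : ZMod f) * gammaOp p g z

/-- `[K]⁺_ψ`, for `K` square-free: the composite of the (commuting) operators `[p]⁺_ψ` over the
primes `p ∣ K`. -/
def opPlusProd {f : ℕ} (ψ : DirichletCharacter ℂ f) (K : ℕ) (g : ℍ → ℂ) : ℍ → ℂ :=
  K.primeFactorsList.foldr (opPlus ψ) g

/-- `[K]⁻_ψ`, for `K` square-free: the composite of the (commuting) operators `[p]⁻_ψ` over the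
primes `p ∣ K`. -/
def opMinusProd {f : ℕ} (ψ : DirichletCharacter ℂ f) (K : ℕ) (g : ℍ → ℂ) : ℍ → ℂ :=
  K.primeFactorsList.foldr (opMinus ψ) g

/-- The Gauss sum `g(ψ) = ∑_{a mod f} ψ(a) e^{2πia/f}`. -/
def gaussG {f : ℕ} [NeZero f] (ψ : DirichletCharacter ℂ f) : ℂ :=
  gaussSum ψ ZMod.stdAddChar

/-- `E_ψ = -1/(2g(ψ)) ∑_{a ∈ (ℤ/f)ˣ} ∑_{b ∈ (ℤ/f²)ˣ} ψ(a) ψ(b) φ_{(a/f, b/f²)}`, for `ψ`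
a primitive Dirichlet character modulo `f`. -/
def eisPsi {f : ℕ} [NeZero f] (ψ : DirichletCharacter ℂ f) (z : ℍ) : ℂ :=
  -(1 / (2 * gaussG ψ)) *
    ∑ a : (ZMod f)ˣ, ∑ b : (ZMod (f ^ 2))ˣ,
      ψ (a : ZMod f) * ψ (((b : ZMod (f ^ 2)).val : ℕ) : ZMod f) *
        heckePhi (((a : ZMod f).val : ℚ) / (f : ℚ)) (((b : ZMod (f ^ 2)).val : ℚ) / (f : ℚ) ^ 2) z

/-- `E_{M,L,ψ} = [L/f]⁻_ψ ∘ [M/f]⁺_ψ (E_ψ)`. -/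
def eis {f : ℕ} [NeZero f] (M L : ℕ) (ψ : DirichletCharacter ℂ f) : ℍ → ℂ :=
  opMinusProd ψ (L / f) (opPlusProd ψ (M / f) (eisPsi ψ))

/-! ### Constant terms, ramification indices, residues -/

/-- The constant term `a₀(g; [γ∞])` of a weight two form `g` at the cusp `γ∞`: the value at `i∞`
of `g | γ`, which is the constant coefficient of the Fourier expansion of `g | γ`. -/
def constTerm (g : ℍ → ℂ) (γ : SL(2, ℤ)) : ℂ := valueAtInfty (g ∣[(2 : ℤ)] γ)

/-- The ramification index over the `j`-line of the modular curve `X_Γ` at the cusp `γ∞`, i.e. the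
width of that cusp: the least `h > 0` such that `γ T^h γ⁻¹` lies in `±Γ`. -/
def ramIndex (Γ : Subgroup SL(2, ℤ)) (γ : SL(2, ℤ)) : ℕ :=
  sInf {h : ℕ | 0 < h ∧
    (γ * ModularGroup.T ^ h * γ⁻¹ ∈ Γ ∨ -(γ * ModularGroup.T ^ h * γ⁻¹) ∈ Γ)}

/-- `R_Γ(g)`: the `ℤ`-submodule of `ℂ` generated by the numbers
`2πi · Res_x(g dz) = e_x · a₀(g; [x])`, for `x` running over the cusps of `X_Γ`. Every cusp is of
the form `x = γ∞` with `γ ∈ SL₂(ℤ)`, and the number depends only on the cusp. -/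
def residueModule (Γ : Subgroup SL(2, ℤ)) (g : ℍ → ℂ) : Submodule ℤ ℂ :=
  Submodule.span ℤ (Set.range fun γ : SL(2, ℤ) => (ramIndex Γ γ : ℂ) * constTerm g γ)

/-! ### The numerical quantities -/

/-- `n_ψ = -f/(4g(ψ)) ∑_{a,b ∈ ℤ/f} ψ(a) ψ(b) B₂((a+b)/f)`. -/
def nPsi {f : ℕ} [NeZero f] (ψ : DirichletCharacter ℂ f) : ℂ :=
  -((f : ℂ) / (4 * gaussG ψ)) *
    ∑ a : ZMod f, ∑ b : ZMod f,
      ψ a * ψ b * ((B2 (((a.val : ℚ) + (b.val : ℚ)) / (f : ℚ)) : ℚ) : ℂ)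

/-- `μ(N) = ∏_{p ∣ N} (p + 1)`, the product being over the primes dividing `N`. -/
def muFun (N : ℕ) : ℕ := ∏ p ∈ N.primeFactors, (p + 1)

end QuadraticEisenstein

end

/-! The function `E_ψ` is a twist of the level one Eisenstein series. Summing Hecke's functions
against `ψ(a)ψ(b)` gives the series `∑ ψ(n)ψ(m) n e(nmz)`. Since `∑_u ψ(u) e(nmu/f) = ψ(nm) g(ψ)`
for primitive quadratic `ψ`, this is `g(ψ)⁻¹ ∑_u ψ(u) E(z + u/f)`, where `E = starE2` is the
non-holomorphic `SL₂(ℤ)`-invariant series (`eisPsi_eq_twistE2`). Translations by `u/f` and the maps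
`z ↦ pz` are slash actions of integral matrices, so modularity and behaviour at the cusps all
descend from `starE2`.

Constant terms are tracked by `HasCuspValues`, which records limits for all integral matrices of
positive determinant and not only for `SL₂(ℤ)`; this makes it stable under slashing by such
matrices. For `starE2` the value at the column `(x, y)` is `-gcd(x, y)²/24`. For the twist,
primitivity of `ψ` collapses the resulting sum of squared gcds: at the cusp `r/s` in lowest terms
the constant term is `n_ψ ψ(r) ψ(s/f)` if `f ∣ s` and `0` otherwise (`twistValue_of_isCoprime`).

Each operator `1 - a ψ(p) γ_p` changes only an Euler factor at `p`, which depends on the `p`-adic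
valuation of `s` (`HasEulerValues.eulerOp`). The cusp width also factors over primes, so a residue
is `n_ψ ψ(r) ψ(s/f)` times a product over `p ∣ D/f` of integer multiples of `localGen` at `p`, with
an extra factor `f` for `Γ₁` (`local_factor`, `residue_Gamma0`, `residue_Gamma1`). The product of
these generators is the number in the theorem. It remains to see that the integer multiples generate
`ℤ`: for `Γ₀` a single cusp gives `±1`, while for `Γ₁` the multiples `p` and `p - 1` at primes
dividing both `M` and `L` are combined by expanding `∏ (p + (1 - p)) = 1`. -/

noncomputable section

namespace QuadraticEisenstein

open UpperHalfPlane Filter Topology EisensteinSeries Matrix Matrix.SpecialLinearGroup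

/-! ### The level one Eisenstein series of weight two -/

/-- The `SL₂(ℤ)`-invariant weight two Eisenstein series
`-1/24 + ∑ σ(n) qⁿ + 1/(8π Im z)`. -/
def starE2 (z : ℍ) : ℂ := -(1 / 24) * E2 z + 1 / (8 * Real.pi * (z.im : ℂ))

/-- The anomaly of `E2` is a multiple of `c/(cz + d)`. The term in `1 / Im z` produces the opposite
one, because the conjugate of `cz + d` is `cz + d - 2ic Im z`. -/
theorem starE2_slash (γ : SL(2, ℤ)) : starE2 ∣[(2 : ℤ)] γ = starE2 := by
  ext z
  have h := congrFun (E2_slash_action γ) z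
  have hd : denom γ z ≠ 0 := denom_ne_zero _ z
  have hpi : (Real.pi : ℂ) ≠ 0 := by exact_mod_cast Real.pi_ne_zero
  have hz : ((z.im : ℝ) : ℂ) ≠ 0 := by exact_mod_cast z.im_ne_zero
  have him : (((γ • z).im : ℝ) : ℂ) = z.im / (denom γ z * (starRingEnd ℂ) (denom γ z)) := by
    rw [ModularGroup.im_smul_eq_div_normSq, Complex.mul_conj]
    push_cast
    rfl
  have hdc : (starRingEnd ℂ) (denom γ z) ≠ 0 := by simp [hd]
  rw [ModularForm.SL_slash_apply] at h ⊢
  simp only [starE2, Pi.sub_apply, Pi.smul_apply, D2, riemannZeta_two, smul_eq_mul] at h ⊢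
  rw [him, add_mul, mul_assoc, h]
  have hconj : (starRingEnd ℂ) (denom γ z) = denom γ z - 2 * Complex.I * (γ 1 0 : ℂ) * z.im := by
    rw [ModularGroup.denom_apply]
    simp only [map_add, map_mul, map_intCast]
    have : (starRingEnd ℂ) (z : ℂ) = (z : ℂ) - 2 * Complex.I * z.im := by
      apply Complex.ext <;> simp <;> ring
    rw [this]; ring
  rw [_root_.zpow_neg, show (denom γ z) ^ (2 : ℤ) = denom γ z ^ 2 by norm_cast]
  have : 1 / (8 * (Real.pi : ℂ) * (z.im / (denom γ z * (starRingEnd ℂ) (denom γ z)))) *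
      (denom γ z ^ 2)⁻¹ = (starRingEnd ℂ) (denom γ z) / (8 * Real.pi * z.im * denom γ z) := by
    field_simp
  rw [this, hconj]
  field_simp
  ring_nf

theorem tendsto_E2_atImInfty : Tendsto E2 atImInfty (𝓝 1) := by
  have hper : Function.Periodic (E2 ∘ ofComplex) ((1 : ℝ) : ℂ) := by
    intro w
    by_cases hw : 0 < w.im
    · have h := congrFun (E2_slash_action ModularGroup.T) ⟨w, hw⟩
      have hd : denom ModularGroup.T (⟨w, hw⟩ : ℍ) = 1 := by
        rw [ModularGroup.denom_apply]; simp [ModularGroup.T]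
      rw [ModularForm.SL_slash_apply, D2_T, modular_T_smul, hd, _root_.one_zpow, mul_one, smul_zero,
        sub_zero] at h
      simp only [Function.comp]
      rw [ofComplex_apply_of_im_pos hw, ← h, ofComplex_apply_of_im_pos (by simpa using hw)]
      congr 1
      apply UpperHalfPlane.ext
      simp [add_comm]
    -- Off the upper half-plane `ofComplex` takes one fixed default value, so periodicity persists
    -- there.
    · simp only [Function.comp]
      rw [ofComplex_apply_of_im_nonpos (not_lt.mp hw),
        ofComplex_apply_of_im_nonpos (by simpa using not_lt.mp hw)]
  have hs : ∀ τ : ℍ, HasSum (fun m : ℕ ↦ (if m = 0 then 1 else -24 * (ArithmeticFunction.sigma 1 m : ℕ) : ℂ) •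
      Function.Periodic.qParam 1 τ ^ m) (E2 τ) := fun τ => by
    simpa only [Function.Periodic.qParam, Complex.ofReal_one, div_one] using hasSum_qExpansion_E2 (z := τ)
  have ha := analyticAt_cuspFunction_zero (h := 1) one_pos hper E2_mdifferentiable isBoundedAtImInfty_E2
  have hb := (hasFPowerSeriesOnBall_cuspFunction one_pos ha hs).hasFPowerSeriesAt
  have h0 : cuspFunction 1 E2 0 = 1 := by
    have := hb.coeff_zero (fun _ => 0)
    simpa using this.symm
  have := (h0 ▸ hb.continuousAt.tendsto).comp (qParam_tendsto_atImInfty one_pos)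
  refine this.congr fun τ => ?_
  exact UpperHalfPlane.eq_cuspFunction τ one_ne_zero hper

theorem tendsto_starE2_atImInfty : Tendsto starE2 atImInfty (𝓝 (-(1 / 24))) := by
  have h1 : Tendsto (fun z : ℍ => 1 / (8 * Real.pi * (z.im : ℂ))) atImInfty (𝓝 0) := by
    have h0 : Tendsto (fun z : ℍ => ((8 * Real.pi * z.im)⁻¹ : ℝ)) atImInfty (𝓝 0) :=
      tendsto_inv_atTop_zero.comp (tendsto_comap.const_mul_atTop (by positivity))
    have := (Complex.continuous_ofReal.tendsto 0).comp h0
    simpa [Function.comp_def] using this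
  have := (tendsto_E2_atImInfty.const_mul (-(1 / 24 : ℂ))).add h1
  rw [mul_one, add_zero] at this
  exact this

/-! ### Values of slash translates at `i∞` -/

/-- `g` has cusp values `κ` if, for every integral matrix `N` of positive determinant with
first column `(x, y)`, the function `g ∣ N` tends to `κ x y / det N` at `i∞`. -/
def HasCuspValues (g : ℍ → ℂ) (κ : ℤ → ℤ → ℂ) : Prop :=
  ∀ (A : GL (Fin 2) ℝ) (N : Matrix (Fin 2) (Fin 2) ℤ), (A : Matrix (Fin 2) (Fin 2) ℝ) =
    N.map (Int.cast : ℤ → ℝ) → 0 < N.det →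
    Tendsto (g ∣[(2 : ℤ)] A) atImInfty (𝓝 (κ (N 0 0) (N 1 0) / (N.det : ℂ)))

theorem det_pos_of_coe_eq {A : GL (Fin 2) ℝ} {N : Matrix (Fin 2) (Fin 2) ℤ}
    (hA : (A : Matrix (Fin 2) (Fin 2) ℝ) = N.map (Int.cast : ℤ → ℝ)) (hN : 0 < N.det) :
    A.det.val = (N.det : ℝ) ∧ 0 < A.det.val := by
  have : A.det.val = (N.det : ℝ) := by
    rw [Matrix.GeneralLinearGroup.val_det_apply, hA]
    exact (Int.cast_det N).symm
  exact ⟨this, by rw [this]; exact_mod_cast hN⟩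

theorem slash_two_apply {A : GL (Fin 2) ℝ} (hA : 0 < A.det.val) (g : ℍ → ℂ) (z : ℍ) :
    (g ∣[(2 : ℤ)] A) z = g (A • z) * (A.det.val : ℂ) * (denom A z ^ 2)⁻¹ := by
  rw [ModularForm.slash_apply, abs_of_pos hA]
  have : σ A = ContinuousAlgEquiv.refl ℝ ℂ := by rw [σ, if_pos hA]
  rw [this]
  rw [_root_.zpow_neg]
  norm_num

theorem smul_slash_of_det_pos {A : GL (Fin 2) ℝ} (hA : 0 < A.det.val) (g : ℍ → ℂ) (c : ℂ) :
    (c • g) ∣[(2 : ℤ)] A = c • (g ∣[(2 : ℤ)] A) := by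
  ext z
  simp only [slash_two_apply hA, Pi.smul_apply, smul_eq_mul]
  ring

namespace HasCuspValues

theorem add {g h : ℍ → ℂ} {κ τ : ℤ → ℤ → ℂ} (hg : HasCuspValues g κ) (hh : HasCuspValues h τ) :
    HasCuspValues (g + h) (fun x y => κ x y + τ x y) := fun A N hA hN => by
  rw [SlashAction.add_slash, add_div]
  exact (hg A N hA hN).add (hh A N hA hN)

theorem smul {g : ℍ → ℂ} {κ : ℤ → ℤ → ℂ} (hg : HasCuspValues g κ) (c : ℂ) :
    HasCuspValues (c • g) (fun x y => c * κ x y) := fun A N hA hN => by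
  rw [smul_slash_of_det_pos (det_pos_of_coe_eq hA hN).2, mul_div_assoc]
  exact (hg A N hA hN).const_mul c

theorem sum {ι : Type*} (s : Finset ι) {g : ι → ℍ → ℂ} {κ : ι → ℤ → ℤ → ℂ}
    (hg : ∀ i ∈ s, HasCuspValues (g i) (κ i)) :
    HasCuspValues (∑ i ∈ s, g i) (fun x y => ∑ i ∈ s, κ i x y) := fun A N hA hN => by
  rw [SlashAction.sum_slash, Finset.sum_div]
  have := tendsto_finsetSum s (fun i hi => hg i hi A N hA hN)
  convert this using 1
  ext z; simp

/-- Slashing by an integral matrix. -/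
theorem slash {g : ℍ → ℂ} {κ : ℤ → ℤ → ℂ} (hg : HasCuspValues g κ) (B : GL (Fin 2) ℝ)
    (N : Matrix (Fin 2) (Fin 2) ℤ) (hB : (B : Matrix (Fin 2) (Fin 2) ℝ) =
    N.map (Int.cast : ℤ → ℝ)) (hN : 0 < N.det) :
    HasCuspValues (g ∣[(2 : ℤ)] B)
      (fun x y => κ (N 0 0 * x + N 0 1 * y) (N 1 0 * x + N 1 1 * y) / (N.det : ℂ)) :=
    fun A P hA hP => by
  rw [← SlashAction.slash_mul]
  have := hg (B * A) (N * P) (by rw [Units.val_mul, hA, hB]; exact (Matrix.map_mul_intCast N P).symm)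
    (by rw [Matrix.det_mul]; positivity)
  convert this using 2
  simp [Matrix.mul_apply, Fin.sum_univ_two, Matrix.det_mul, div_div]

end HasCuspValues

/-- The upper triangular integral matrix `(a, b; 0, d)` as a real matrix. -/
def upperGL (a d : ℕ) (b : ℤ) (ha : a ≠ 0) (hd : d ≠ 0) : GL (Fin 2) ℝ :=
  Matrix.GeneralLinearGroup.mkOfDetNeZero !![(a : ℝ), b; 0, d]
    (by simp [Matrix.det_fin_two, ha, hd])

theorem coe_upperGL (a d : ℕ) (b : ℤ) (ha : a ≠ 0) (hd : d ≠ 0) :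
    (upperGL a d b ha hd : Matrix (Fin 2) (Fin 2) ℝ) = !![(a : ℝ), b; 0, d] := rfl

theorem coe_upperGL_map (a d : ℕ) (b : ℤ) (ha : a ≠ 0) (hd : d ≠ 0) :
    (upperGL a d b ha hd : Matrix (Fin 2) (Fin 2) ℝ) =
      (!![(a : ℤ), b; 0, (d : ℤ)]).map (Int.cast : ℤ → ℝ) := by
  rw [coe_upperGL]
  ext i j
  fin_cases i <;> fin_cases j <;> simp

theorem det_upperGL (a d : ℕ) (b : ℤ) (ha : a ≠ 0) (hd : d ≠ 0) :
    (upperGL a d b ha hd).det.val = (a : ℝ) * d := by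
  rw [Matrix.GeneralLinearGroup.val_det_apply, coe_upperGL]
  simp [Matrix.det_fin_two]

theorem det_upperGL_pos (a d : ℕ) (b : ℤ) (ha : a ≠ 0) (hd : d ≠ 0) :
    0 < (upperGL a d b ha hd).det.val := by
  rw [det_upperGL]; positivity

theorem coe_upperGL_smul (a d : ℕ) (b : ℤ) (ha : a ≠ 0) (hd : d ≠ 0) (z : ℍ) :
    ((upperGL a d b ha hd • z : ℍ) : ℂ) = (a * z + b) / d := by
  rw [coe_smul_of_det_pos (det_upperGL_pos a d b ha hd)]
  simp [num, denom, coe_upperGL]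

theorem slash_upperGL (a d : ℕ) (b : ℤ) (ha : a ≠ 0) (hd : d ≠ 0) (g : ℍ → ℂ) (z : ℍ) :
    (g ∣[(2 : ℤ)] upperGL a d b ha hd) z = (a / d : ℂ) * g (upperGL a d b ha hd • z) := by
  rw [slash_two_apply (det_upperGL_pos a d b ha hd), det_upperGL]
  have : denom (upperGL a d b ha hd) z = d := by simp [denom, coe_upperGL]
  rw [this]
  have : (d : ℂ) ≠ 0 := by exact_mod_cast hd
  push_cast
  field_simp

/-- Every integral matrix of positive determinant is upper triangular up to left
multiplication by `SL₂(ℤ)`. -/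
theorem exists_SL2_mul_eq_upper (N : Matrix (Fin 2) (Fin 2) ℤ) (hN : 0 < N.det) :
    ∃ (γ : SL(2, ℤ)) (b : ℤ) (d : ℕ), d ≠ 0 ∧ Int.gcd (N 0 0) (N 1 0) ≠ 0 ∧
      (γ : Matrix (Fin 2) (Fin 2) ℤ) * N = !![(Int.gcd (N 0 0) (N 1 0) : ℤ), b; 0, (d : ℤ)] ∧
      N.det = Int.gcd (N 0 0) (N 1 0) * d := by
  set g := Int.gcd (N 0 0) (N 1 0) with hgdef
  have hg : g ≠ 0 := by
    intro h
    have := Int.gcd_eq_zero_iff.mp h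
    rw [Matrix.det_fin_two, this.1, this.2] at hN
    simp at hN
  have hgpos : 0 < g := Nat.pos_of_ne_zero hg
  obtain ⟨x, hx⟩ : (g : ℤ) ∣ N 0 0 := Int.gcd_dvd_left ..
  obtain ⟨y, hy⟩ : (g : ℤ) ∣ N 1 0 := Int.gcd_dvd_right ..
  have hbez := Int.gcd_eq_gcd_ab (N 0 0) (N 1 0)
  rw [← hgdef] at hbez
  set u := Int.gcdA (N 0 0) (N 1 0)
  set v := Int.gcdB (N 0 0) (N 1 0)
  have huv : u * x + v * y = 1 := by
    have : (g : ℤ) * (u * x + v * y) = g * 1 := by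
      linear_combination -hbez - u * hx - v * hy
    exact mul_left_cancel₀ (by exact_mod_cast hg) this
  -- The first row holds the Bézout coefficients of the first column of `N`; the second row
  -- annihilates that column.
  let γ : SL(2, ℤ) := ⟨!![u, v; -y, x], by rw [Matrix.det_fin_two]; simp; linarith⟩
  have hdd : N.det = g * (-y * N 0 1 + x * N 1 1) := by
    rw [Matrix.det_fin_two]; nth_rw 1 [hx]; nth_rw 1 [hy]; ring
  have hpos : 0 < -y * N 0 1 + x * N 1 1 := by
    rw [hdd] at hN
    exact pos_of_mul_pos_right hN (by positivity)
  refine ⟨γ, u * N 0 1 + v * N 1 1, (-y * N 0 1 + x * N 1 1).toNat, ?_, hg, ?_, ?_⟩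
  · omega
  · rw [Int.toNat_of_nonneg hpos.le]
    ext i j
    fin_cases i <;> fin_cases j <;> simp [γ, Matrix.mul_apply, Fin.sum_univ_two]
    · rw [hbez]; ring
    · rw [hx, hy]; ring
  · rw [Int.toNat_of_nonneg hpos.le, hdd]

/-- By `SL₂(ℤ)`-invariance the matrix may be taken upper triangular with diagonal `(g, d)`, where
`g` is the gcd of the first column. The limit is then `-(1/24) g/d = -(1/24) g²/(gd)`, and `gd` is
the determinant. -/
theorem hasCuspValues_starE2 :
    HasCuspValues starE2 (fun x y => -(1 / 24) * (Int.gcd x y : ℂ) ^ 2) := fun A N hA hN => by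
  obtain ⟨γ, b, d, hd, hg, hmul, hdet⟩ := exists_SL2_mul_eq_upper N hN
  have hGL : (mapGL ℝ γ : GL (Fin 2) ℝ) * A = upperGL _ d b hg hd := by
    apply Units.ext
    rw [Units.val_mul, hA, coe_upperGL_map, ← hmul]
    rw [Matrix.map_mul_intCast]
    rfl
  have hs : starE2 ∣[(2 : ℤ)] A = starE2 ∣[(2 : ℤ)] upperGL _ d b hg hd := by
    rw [← hGL, SlashAction.slash_mul]
    congr 1
    exact (starE2_slash γ).symm
  rw [hs]
  have ht := (tendsto_starE2_atImInfty.comp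
    (tendsto_smul_atImInfty (g := upperGL _ d b hg hd) (by simp [coe_upperGL]))).const_mul
    ((Int.gcd (N 0 0) (N 1 0) : ℂ) / d)
  convert ht using 1
  · ext z; rw [slash_upperGL]; rfl
  · rw [hdet]
    have : (Int.gcd (N 0 0) (N 1 0) : ℂ) ≠ 0 := by exact_mod_cast hg
    have : (d : ℂ) ≠ 0 := by exact_mod_cast hd
    push_cast
    congr 1
    field_simp

theorem gammaOp_eq_slash {p : ℕ} (hp : p ≠ 0) (g : ℍ → ℂ) :
    gammaOp p g = g ∣[(2 : ℤ)] upperGL p 1 0 hp one_ne_zero := by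
  ext z
  rw [slash_upperGL, gammaOp]
  have him : 0 < ((p : ℂ) * (z : ℂ)).im := by
    simp only [Complex.mul_im, Complex.natCast_re, Complex.natCast_im, zero_mul, add_zero]
    exact mul_pos (by exact_mod_cast Nat.pos_of_ne_zero hp) z.im_pos
  have : ofComplex ((p : ℂ) * (z : ℂ)) = upperGL p 1 0 hp one_ne_zero • z := by
    apply UpperHalfPlane.ext
    rw [coe_upperGL_smul, ofComplex_apply_of_im_pos him]
    simp
  rw [this]; simp

theorem HasCuspValues.gammaOp {g : ℍ → ℂ} {κ : ℤ → ℤ → ℂ} (hg : HasCuspValues g κ) {p : ℕ}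
    (hp : p ≠ 0) : HasCuspValues (gammaOp p g) (fun x y => κ (p * x) y / p) := by
  rw [gammaOp_eq_slash hp]
  have := hg.slash (upperGL p 1 0 hp one_ne_zero) _ (coe_upperGL_map p 1 0 hp one_ne_zero)
    (by simp [Matrix.det_fin_two]; omega)
  simpa [Matrix.det_fin_two] using this

/-- The constant term of a function with cusp values. -/
theorem HasCuspValues.tendsto_slash {g : ℍ → ℂ} {κ : ℤ → ℤ → ℂ} (hg : HasCuspValues g κ)
    (γ : SL(2, ℤ)) : Tendsto (g ∣[(2 : ℤ)] γ) atImInfty (𝓝 (κ (γ 0 0) (γ 1 0))) := by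
  have := hg (mapGL ℝ γ) γ rfl (by rw [γ.det_coe]; exact one_pos)
  rw [γ.det_coe] at this
  simp only [Int.cast_one, div_one] at this
  exact this

theorem HasCuspValues.constTerm {g : ℍ → ℂ} {κ : ℤ → ℤ → ℂ} (hg : HasCuspValues g κ)
    (γ : SL(2, ℤ)) : constTerm g γ = κ (γ 0 0) (γ 1 0) :=
  (hg.tendsto_slash γ).limUnder_eq

end QuadraticEisenstein

end

noncomputable section

namespace QuadraticEisenstein

open UpperHalfPlane Filter Topology EisensteinSeries Matrix Matrix.SpecialLinearGroup
open scoped Manifold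

/-! ### Invariance under `Γ₀(N)` -/

theorem upperGL_mul_mapGL {a d a' d' : ℕ} {b b' : ℤ} (ha : a ≠ 0) (hd : d ≠ 0) (ha' : a' ≠ 0)
    (hd' : d' ≠ 0) (γ γ' : SL(2, ℤ)) (h : !![(a : ℤ), b; 0, (d : ℤ)] * γ.1 =
      γ'.1 * !![(a' : ℤ), b'; 0, (d' : ℤ)]) :
    upperGL a d b ha hd * (mapGL ℝ γ : GL (Fin 2) ℝ) =
      (mapGL ℝ γ' : GL (Fin 2) ℝ) * upperGL a' d' b' ha' hd' := by
  apply Units.ext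
  have hm : ∀ γ : SL(2, ℤ), ((mapGL ℝ γ : GL (Fin 2) ℝ) : Matrix (Fin 2) (Fin 2) ℝ) =
    γ.1.map (Int.cast : ℤ → ℝ) := fun _ => rfl
  rw [Units.val_mul, Units.val_mul, coe_upperGL_map, coe_upperGL_map, hm, hm,
    ← Matrix.map_mul_intCast, ← Matrix.map_mul_intCast, h]

/-- Weight two invariance under `Γ₀(N)`. -/
def IsGamma0Invariant (N : ℕ) (g : ℍ → ℂ) : Prop :=
  ∀ γ ∈ CongruenceSubgroup.Gamma0 N, g ∣[(2 : ℤ)] γ = g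

namespace IsGamma0Invariant

theorem mono {N K : ℕ} {g : ℍ → ℂ} (hg : IsGamma0Invariant N g) (h : N ∣ K) :
    IsGamma0Invariant K g := fun γ hγ => by
  refine hg γ ?_
  rw [CongruenceSubgroup.Gamma0_mem, ZMod.intCast_zmod_eq_zero_iff_dvd] at hγ ⊢
  exact (Int.natCast_dvd_natCast.mpr h).trans hγ

theorem add {N : ℕ} {g h : ℍ → ℂ} (hg : IsGamma0Invariant N g) (hh : IsGamma0Invariant N h) :
    IsGamma0Invariant N (g + h) := fun γ hγ => by
  rw [SlashAction.add_slash, hg γ hγ, hh γ hγ]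

theorem smul {N : ℕ} {g : ℍ → ℂ} (hg : IsGamma0Invariant N g) (c : ℂ) :
    IsGamma0Invariant N (c • g) := fun γ hγ => by
  rw [ModularForm.SL_smul_slash, hg γ hγ]

theorem gammaOp {N p : ℕ} {g : ℍ → ℂ} (hg : IsGamma0Invariant N g) (hp : p ≠ 0) :
    IsGamma0Invariant (N * p) (gammaOp p g) := fun γ hγ => by
  rw [CongruenceSubgroup.Gamma0_mem, ZMod.intCast_zmod_eq_zero_iff_dvd] at hγ
  obtain ⟨c, hc⟩ := hγ
  have hdet := γ.det_coe
  rw [Matrix.det_fin_two, hc] at hdet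
  push_cast at hdet
  -- The conjugate of `γ` by `diag(p, 1)`.
  let γ' : SL(2, ℤ) := ⟨!![γ 0 0, p * γ 0 1; N * c, γ 1 1], by
    rw [Matrix.det_fin_two]; simp; linear_combination hdet⟩
  have hγ' : γ' ∈ CongruenceSubgroup.Gamma0 N := by
    rw [CongruenceSubgroup.Gamma0_mem]
    simp [γ']
  rw [gammaOp_eq_slash hp]
  have hmul : upperGL p 1 0 hp one_ne_zero * (mapGL ℝ γ : GL (Fin 2) ℝ) =
      (mapGL ℝ γ' : GL (Fin 2) ℝ) * upperGL p 1 0 hp one_ne_zero := by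
    refine upperGL_mul_mapGL _ _ _ _ γ γ' ?_
    ext i j
    fin_cases i <;> fin_cases j <;> simp [γ', Matrix.mul_apply, Fin.sum_univ_two, hc] <;> ring
  change (g ∣[(2 : ℤ)] upperGL p 1 0 hp one_ne_zero) ∣[(2 : ℤ)] (mapGL ℝ γ : GL (Fin 2) ℝ) = _
  rw [← SlashAction.slash_mul, hmul, SlashAction.slash_mul]
  congr 1
  exact hg γ' hγ'

end IsGamma0Invariant

/-! ### The twist of the level one Eisenstein series -/
theorem sq_eq_one_of_isQuadratic {f : ℕ} {ψ : DirichletCharacter ℂ f} (hquad : ψ.IsQuadratic)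
    {a : ZMod f} (ha : IsUnit a) : ψ a ^ 2 = 1 := by
  rcases hquad a with h | h | h
  · exact absurd h (ha.map ψ).ne_zero
  · rw [h]; norm_num
  · rw [h]; norm_num

section Twist

variable {f : ℕ} [NeZero f]

/-- The translate `z ↦ starE2 (z + u / f)`. -/
def shiftE2 (u : ZMod f) : ℍ → ℂ :=
  starE2 ∣[(2 : ℤ)] upperGL f f u.val (NeZero.ne f) (NeZero.ne f)

/-- The twist `g(ψ)⁻¹ ∑_u ψ(u) starE2 (z + u / f)`. -/
def twistE2 (ψ : DirichletCharacter ℂ f) : ℍ → ℂ :=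
  (1 / gaussG ψ) • ∑ u : ZMod f, ψ u • shiftE2 u

/-- The cusp values of the twist. -/
def twistValue (ψ : DirichletCharacter ℂ f) (x y : ℤ) : ℂ :=
  1 / gaussG ψ * ∑ u : ZMod f, ψ u *
    (-(1 / 24) * (Int.gcd (f * x + u.val * y) (f * y) : ℂ) ^ 2 / ((f : ℂ) * f))

theorem hasCuspValues_twistE2 (ψ : DirichletCharacter ℂ f) :
    HasCuspValues (twistE2 ψ) (twistValue ψ) := by
  have h0 : 0 < f := Nat.pos_of_ne_zero (NeZero.ne f)
  have key : ∀ u : ZMod f, HasCuspValues (shiftE2 u) (fun x y =>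
      -(1 / 24) * (Int.gcd (f * x + u.val * y) (f * y) : ℂ) ^ 2 / ((f : ℂ) * f)) := fun u => by
    have := hasCuspValues_starE2.slash (upperGL f f u.val (NeZero.ne f) (NeZero.ne f)) _
      (coe_upperGL_map f f u.val (NeZero.ne f) (NeZero.ne f))
      (by simp [Matrix.det_fin_two]; positivity)
    unfold shiftE2
    simpa [Matrix.det_fin_two, -ZMod.natCast_val] using this
  exact (HasCuspValues.sum Finset.univ fun u _ => (key u).smul (ψ u)).smul (1 / gaussG ψ)


/-- Moving `γ = (a, b; f²c, d)` across the translation by `u/f` turns it into a translation by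
`v/f`, provided `ud ≡ av` modulo `f`. As `ad ≡ 1`, this forces `v = d²u`. A quadratic character does
not see the factor `d²`, hence the twist has trivial nebentypus. -/
theorem shiftE2_slash (γ : SL(2, ℤ)) (hγ : γ ∈ CongruenceSubgroup.Gamma0 (f ^ 2)) (u : ZMod f) :
    shiftE2 u ∣[(2 : ℤ)] γ = shiftE2 (((γ 1 1 : ℤ) : ZMod f) ^ 2 * u) := by
  rw [CongruenceSubgroup.Gamma0_mem, ZMod.intCast_zmod_eq_zero_iff_dvd] at hγ
  obtain ⟨c, hc⟩ := hγ
  have hdet := γ.det_coe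
  rw [Matrix.det_fin_two, hc] at hdet
  push_cast at hdet
  set v : ZMod f := ((γ 1 1 : ℤ) : ZMod f) ^ 2 * u with hv
  obtain ⟨w, hw⟩ : (f : ℤ) ∣ u.val * γ 1 1 - γ 0 0 * v.val := by
    rw [← ZMod.intCast_zmod_eq_zero_iff_dvd]
    have hd := congrArg (Int.cast : ℤ → ZMod f) hdet
    push_cast at hd ⊢
    simp only [ZMod.natCast_zmod_val, CharP.cast_eq_zero] at hd ⊢
    rw [hv]
    linear_combination (-u * ((γ 1 1 : ℤ) : ZMod f)) * hd
  let γ' : SL(2, ℤ) := ⟨!![γ 0 0 + u.val * f * c, γ 0 1 + w - u.val * v.val * c; f ^ 2 * c,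
    γ 1 1 - f * c * v.val], by
    rw [Matrix.det_fin_two]; simp [-ZMod.natCast_val]; linear_combination hdet + f * c * hw⟩
  have hmul : upperGL f f u.val (NeZero.ne f) (NeZero.ne f) * (mapGL ℝ γ : GL (Fin 2) ℝ) =
      (mapGL ℝ γ' : GL (Fin 2) ℝ) * upperGL f f v.val (NeZero.ne f) (NeZero.ne f) := by
    refine upperGL_mul_mapGL _ _ _ _ γ γ' ?_
    ext i j
    fin_cases i <;> fin_cases j <;>
      simp [γ', Matrix.mul_apply, Fin.sum_univ_two, hc, -ZMod.natCast_val]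
    · ring
    · linear_combination hw
    · ring
    · ring
  change (starE2 ∣[(2 : ℤ)] _) ∣[(2 : ℤ)] (mapGL ℝ γ : GL (Fin 2) ℝ) = starE2 ∣[(2 : ℤ)] _
  rw [← SlashAction.slash_mul, hmul, SlashAction.slash_mul]
  congr 1
  exact starE2_slash γ'

theorem isGamma0Invariant_twistE2 {ψ : DirichletCharacter ℂ f} (hquad : ψ.IsQuadratic) :
    IsGamma0Invariant (f ^ 2) (twistE2 ψ) := fun γ hγ => by
  have hu : IsUnit ((γ 1 1 : ℤ) : ZMod f) := by
    rw [CongruenceSubgroup.Gamma0_mem, ZMod.intCast_zmod_eq_zero_iff_dvd] at hγ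
    obtain ⟨c, hc⟩ := hγ
    have hdet := congrArg (Int.cast : ℤ → ZMod f) γ.det_coe
    rw [Matrix.det_fin_two, hc] at hdet
    push_cast at hdet
    refine IsUnit.of_mul_eq_one ((γ 0 0 : ℤ) : ZMod f) ?_
    simp only [CharP.cast_eq_zero] at hdet
    linear_combination hdet
  rw [twistE2, ModularForm.SL_smul_slash, SlashAction.sum_slash]
  congr 1
  refine Fintype.sum_bijective (fun u => ((γ 1 1 : ℤ) : ZMod f) ^ 2 * u)
    (IsUnit.isUnit_iff_mulLeft_bijective.mp (hu.pow 2)) _ _ fun u => ?_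
  rw [ModularForm.SL_smul_slash, shiftE2_slash γ hγ, map_mul, map_pow,
    sq_eq_one_of_isQuadratic hquad hu, one_mul]

end Twist

/-! ### Holomorphy -/

/-- `g` is holomorphic up to the non-holomorphic term `t / Im z`. -/
def IsHolomorphicUpTo (t : ℂ) (g : ℍ → ℂ) : Prop :=
  MDiff (fun z : ℍ => g z - t / ((z.im : ℝ) : ℂ))

namespace IsHolomorphicUpTo

theorem add {s t : ℂ} {g h : ℍ → ℂ} (hg : IsHolomorphicUpTo s g) (hh : IsHolomorphicUpTo t h) :
    IsHolomorphicUpTo (s + t) (g + h) := by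
  unfold IsHolomorphicUpTo
  convert MDifferentiable.add hg hh using 1
  ext z; simp; ring

theorem smul {t : ℂ} {g : ℍ → ℂ} (hg : IsHolomorphicUpTo t g) (c : ℂ) :
    IsHolomorphicUpTo (c * t) (c • g) := by
  unfold IsHolomorphicUpTo
  convert MDifferentiable.const_smul c hg using 1
  ext z; simp; ring

theorem sum {ι : Type*} (s : Finset ι) {t : ι → ℂ} {g : ι → ℍ → ℂ}
    (hg : ∀ i ∈ s, IsHolomorphicUpTo (t i) (g i)) :
    IsHolomorphicUpTo (∑ i ∈ s, t i) (∑ i ∈ s, g i) := by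
  classical
  induction s using Finset.induction_on with
  | empty =>
    simp only [Finset.sum_empty, IsHolomorphicUpTo, Pi.zero_apply, zero_div, sub_zero]
    exact mdifferentiable_const
  | insert i s hi ih =>
    rw [Finset.sum_insert hi, Finset.sum_insert hi]
    exact (hg i (Finset.mem_insert_self i s)).add
      (ih fun j hj => hg j (Finset.mem_insert_of_mem hj))

/-- The slash multiplies by `a/d`, and `Im z` is scaled by the same `a/d`, so the term `t / Im z` is
reproduced unchanged. -/
theorem slash_upperGL {t : ℂ} {g : ℍ → ℂ} (hg : IsHolomorphicUpTo t g) {a d : ℕ} (b : ℤ)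
    (ha : a ≠ 0) (hd : d ≠ 0) :
    IsHolomorphicUpTo t (g ∣[(2 : ℤ)] upperGL a d b ha hd) := by
  have hcomp := MDifferentiable.const_smul (a / d : ℂ)
    (MDifferentiable.comp hg (mdifferentiable_smul (det_upperGL_pos a d b ha hd)))
  unfold IsHolomorphicUpTo
  have heq : (fun z : ℍ => (g ∣[(2 : ℤ)] upperGL a d b ha hd) z - t / ((z.im : ℝ) : ℂ)) =
      (a / d : ℂ) • ((fun z : ℍ => g z - t / ((z.im : ℝ) : ℂ)) ∘
        fun τ : ℍ => upperGL a d b ha hd • τ) := by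
    funext z
    have him : (upperGL a d b ha hd • z : ℍ).im = (a : ℝ) / d * z.im := by
      rw [← coe_im, coe_upperGL_smul]
      have : ((a : ℂ) * z + b) / d = ((a / d : ℝ) : ℂ) * z + ((b / d : ℝ) : ℂ) := by
        push_cast; ring
      rw [this]
      simp
    have h1 : (a : ℂ) ≠ 0 := by exact_mod_cast ha
    have h2 : (d : ℂ) ≠ 0 := by exact_mod_cast hd
    rw [QuadraticEisenstein.slash_upperGL]
    simp only [Pi.smul_apply, Function.comp_apply, smul_eq_mul, him]
    push_cast
    rw [mul_sub]
    congr 1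
    field_simp
  rw [heq]
  exact hcomp

theorem gammaOp {t : ℂ} {g : ℍ → ℂ} (hg : IsHolomorphicUpTo t g) {p : ℕ} (hp : p ≠ 0) :
    IsHolomorphicUpTo t (gammaOp p g) := by
  rw [gammaOp_eq_slash hp]
  exact hg.slash_upperGL 0 hp one_ne_zero

end IsHolomorphicUpTo

theorem isHolomorphicUpTo_starE2 : IsHolomorphicUpTo (1 / (8 * Real.pi)) starE2 := by
  unfold IsHolomorphicUpTo
  convert MDifferentiable.const_smul (-(1 / 24) : ℂ) E2_mdifferentiable using 1
  ext z
  simp only [starE2, Pi.smul_apply, smul_eq_mul, div_div]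
  ring

theorem isHolomorphicUpTo_twistE2 {f : ℕ} [NeZero f] (ψ : DirichletCharacter ℂ f) :
    IsHolomorphicUpTo (1 / gaussG ψ * ∑ u : ZMod f, ψ u * (1 / (8 * Real.pi))) (twistE2 ψ) :=
  (IsHolomorphicUpTo.sum Finset.univ fun u _ =>
    (isHolomorphicUpTo_starE2.slash_upperGL _ (NeZero.ne f) (NeZero.ne f)).smul (ψ u)).smul _

end QuadraticEisenstein

end

noncomputable section

namespace QuadraticEisenstein

open UpperHalfPlane Filter Topology EisensteinSeries

/-! ### Character sums -/

/-- `e(w) = exp(2πiw)`. -/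
def e2pi (w : ℂ) : ℂ := Complex.exp (2 * Real.pi * Complex.I * w)

theorem e2pi_add (v w : ℂ) : e2pi (v + w) = e2pi v * e2pi w := by
  rw [e2pi, mul_add, Complex.exp_add]; rfl

theorem e2pi_intCast (n : ℤ) : e2pi n = 1 := by
  rw [e2pi, mul_comm]; exact Complex.exp_int_mul_two_pi_mul_I n

theorem e2pi_natCast_mul (n : ℕ) (w : ℂ) : e2pi (n * w) = e2pi w ^ n := by
  rw [e2pi, e2pi, ← Complex.exp_nat_mul]; congr 1; ring

theorem norm_e2pi_lt_one {w : ℂ} (hw : 0 < w.im) : ‖e2pi w‖ < 1 :=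
  norm_exp_two_pi_I_lt_one ⟨w, hw⟩

theorem norm_e2pi_ratCast (x : ℚ) : ‖e2pi x‖ = 1 := by
  have : 2 * Real.pi * Complex.I * ((x : ℚ) : ℂ) = ((2 * Real.pi * (x : ℝ) : ℝ) : ℂ) * Complex.I := by
    push_cast; ring
  rw [e2pi, this]
  exact Complex.norm_exp_ofReal_mul_I _

theorem sum_zmod_val {R : Type*} [AddCommMonoid R] (n : ℕ) [NeZero n] (F : ℕ → R) :
    ∑ u : ZMod n, F u.val = ∑ i ∈ Finset.range n, F i := by
  refine Finset.sum_bij' (fun u _ => u.val) (fun i _ => (i : ZMod n)) ?_ ?_ ?_ ?_ ?_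
  · intro u _; exact Finset.mem_range.mpr (ZMod.val_lt u)
  · intro i _; exact Finset.mem_univ _
  · intro u _; exact ZMod.natCast_zmod_val u
  · intro i hi; exact ZMod.val_cast_of_lt (Finset.mem_range.mp hi)
  · intro u _; rfl

theorem sum_range_mul {R : Type*} [AddCommMonoid R] (n k : ℕ) (F : ℕ → R) :
    ∑ i ∈ Finset.range (n * k), F i =
      ∑ j ∈ Finset.range k, ∑ u ∈ Finset.range n, F (u + n * j) := by
  rw [← Finset.sum_product']
  rcases Nat.eq_zero_or_pos n with rfl | hn
  · simp
  refine Finset.sum_bij' (fun i _ => (i / n, i % n)) (fun p _ => p.2 + n * p.1) ?_ ?_ ?_ ?_ ?_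
  · intro i hi
    rw [Finset.mem_range] at hi
    simp only [Finset.mem_product, Finset.mem_range]
    exact ⟨Nat.div_lt_of_lt_mul hi, Nat.mod_lt _ hn⟩
  · rintro ⟨j, u⟩ h
    simp only [Finset.mem_product, Finset.mem_range] at h ⊢
    nlinarith
  · intro i _; exact Nat.mod_add_div i n
  · rintro ⟨j, u⟩ h
    simp only [Finset.mem_product, Finset.mem_range] at h
    simp [Nat.add_mul_div_left, hn, Nat.div_eq_of_lt h.2, Nat.mod_eq_of_lt h.2]
  · intro i _; rw [Nat.mod_add_div i n]

section

variable {f : ℕ} [NeZero f]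

theorem e2pi_eq_stdAddChar (m : ℤ) (u : ZMod f) :
    e2pi (m * (u.val / f)) = ZMod.stdAddChar ((m : ZMod f) * u) := by
  have h : (m : ZMod f) * u = ((m * u.val : ℤ) : ZMod f) := by
    push_cast; rw [ZMod.natCast_zmod_val]
  rw [h, ZMod.stdAddChar_coe, e2pi]
  congr 1
  push_cast
  ring

theorem sum_char_mul_e2pi {ψ : DirichletCharacter ℂ f} (hprim : ψ.IsPrimitive)
    (hquad : ψ.IsQuadratic) (m : ℤ) :
    ∑ u : ZMod f, ψ u * e2pi (m * (u.val / f)) = ψ m * gaussG ψ := by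
  have h := gaussSum_mulShift_of_isPrimitive (e := ZMod.stdAddChar) hprim (m : ZMod f)
  rw [hquad.inv] at h
  rw [gaussG, ← h, gaussSum]
  refine Finset.sum_congr rfl fun u _ => ?_
  rw [e2pi_eq_stdAddChar, AddChar.mulShift_apply]

theorem sum_e2pi_range (m : ℤ) :
    ∑ j ∈ Finset.range f, e2pi (m * (j / f)) = if (f : ℤ) ∣ m then (f : ℂ) else 0 := by
  rw [← sum_zmod_val f (fun j => e2pi (m * (j / f)))]
  simp_rw [e2pi_eq_stdAddChar]
  have h := AddChar.sum_mulShift (m : ZMod f) (ZMod.isPrimitive_stdAddChar f)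
  simp_rw [mul_comm (m : ZMod f)]
  rw [h, ZMod.card]
  simp only [ZMod.intCast_zmod_eq_zero_iff_dvd]
  split_ifs <;> simp

theorem sum_units_eq_sum {R : Type*} [CommRing R] {n : ℕ} [NeZero n] (G : ZMod n → R)
    (hG : ∀ b, ¬ IsUnit b → G b = 0) : ∑ b : (ZMod n)ˣ, G b = ∑ b : ZMod n, G b := by
  classical
  refine Finset.sum_of_injOn (fun b : (ZMod n)ˣ => (b : ZMod n)) Units.val_injective.injOn
    (fun _ _ => Finset.mem_coe.mpr (Finset.mem_univ _)) (fun b _ hb => hG b fun hu => hb ?_)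
    (fun _ _ => rfl)
  exact ⟨hu.unit, by simp, hu.unit_spec⟩

/-- Writing `b = u + fj`, the sum over `j` is `f` or `0` according as `f ∣ m`, and the sum over `u`
is then a twisted Gauss sum modulo `f`. This is what the denominator `f²` in the definition of `E_ψ`
is for: only multiples of `f` survive in the second index. -/
theorem sum_units_sq_char_mul_e2pi {ψ : DirichletCharacter ℂ f} (hprim : ψ.IsPrimitive)
    (hquad : ψ.IsQuadratic) (m : ℤ) :
    ∑ b : (ZMod (f ^ 2))ˣ, ψ (((b : ZMod (f ^ 2)).val : ℕ) : ZMod f) *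
      e2pi (m * ((b : ZMod (f ^ 2)).val / (f : ℂ) ^ 2)) =
    if (f : ℤ) ∣ m then f * (ψ ((m / f : ℤ) : ZMod f) * gaussG ψ) else 0 := by
  have hf : (f : ℂ) ≠ 0 := by exact_mod_cast NeZero.ne f
  rw [sum_units_eq_sum (fun b : ZMod (f ^ 2) => ψ ((b.val : ℕ) : ZMod f) *
      e2pi (m * (b.val / (f : ℂ) ^ 2)))]
  swap
  · intro b hb
    rw [MulChar.map_nonunit, zero_mul]
    rwa [ZMod.isUnit_iff_coprime, ← Nat.coprime_pow_right_iff (n := 2) two_pos,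
      ← ZMod.isUnit_iff_coprime, ZMod.natCast_zmod_val]
  rw [sum_zmod_val (f ^ 2) (fun b => ψ ((b : ℕ) : ZMod f) * e2pi (m * (b / (f : ℂ) ^ 2))),
    pow_two f, sum_range_mul]
  have hterm : ∀ j u : ℕ, ψ ((u + f * j : ℕ) : ZMod f) *
      e2pi (m * ((u + f * j : ℕ) / (f : ℂ) ^ 2)) =
      (ψ (u : ZMod f) * e2pi (m * (u / (f : ℂ) ^ 2))) * e2pi (m * (j / f)) := fun j u => by
    have : (m : ℂ) * ((u + f * j : ℕ) / (f : ℂ) ^ 2) = m * (u / (f : ℂ) ^ 2) + m * (j / f) := by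
      push_cast; field_simp
    rw [this, e2pi_add]
    push_cast
    simp [mul_assoc]
  simp_rw [hterm, ← Finset.sum_mul, ← Finset.mul_sum]
  rw [sum_e2pi_range]
  split_ifs with h
  · obtain ⟨k, rfl⟩ := h
    rw [Int.mul_ediv_cancel_left _ (by exact_mod_cast NeZero.ne f), mul_comm,
      ← sum_char_mul_e2pi hprim hquad k,
      ← sum_zmod_val f (fun u => ψ (u : ZMod f) * e2pi (((f * k : ℤ) : ℂ) * (u / (f : ℂ) ^ 2)))]
    congr 1
    refine Finset.sum_congr rfl fun u _ => ?_
    rw [ZMod.natCast_zmod_val]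
    congr 2
    push_cast
    field_simp
  · rw [mul_zero]

end

/-! ### Hecke's series as a double sum -/

theorem summable_pair {w : ℂ} (hw : 0 < w.im) {c : ℕ+ × ℕ+ → ℂ} {B : ℝ} (hc : ∀ p, ‖c p‖ ≤ B) :
    Summable fun p : ℕ+ × ℕ+ => c p * ((p.1 : ℂ) * e2pi (p.1 * p.2 * w)) := by
  have h := (summable_prod_mul_pow 1 (norm_e2pi_lt_one hw)).prod_symm
  refine Summable.of_norm_bounded (h.norm.mul_left B) fun p => ?_
  rw [norm_mul]
  refine mul_le_mul (hc p) (le_of_eq ?_) (norm_nonneg _) ((norm_nonneg _).trans (hc p))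
  congr 1
  rw [← Nat.cast_mul, e2pi_natCast_mul]
  simp [mul_comm]

/-- The positive rationals congruent to `A/f` modulo 1 are the `n/f` with `n ≡ A` modulo `f`.
Encoding the congruence as a coefficient puts all the series for varying `A` on one index set, ready
for interchange with finite character sums. -/
theorem heckeP_eq_tsum {f : ℕ} [NeZero f] (A : ℤ) (x : ℚ) (z : ℍ) :
    heckeP ((A : ℚ) / f) x z = ∑' p : ℕ+ × ℕ+,
      ((if (f : ℤ) ∣ p.1 - A then (f : ℂ)⁻¹ else 0) * e2pi (p.2 * x)) *
        ((p.1 : ℂ) * e2pi (p.1 * p.2 * (z / f))) := by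
  have hfpos : (0 : ℚ) < f := by exact_mod_cast Nat.pos_of_ne_zero (NeZero.ne f)
  have hfC : (f : ℂ) ≠ 0 := by exact_mod_cast NeZero.ne f
  have him : 0 < ((z : ℂ) / f).im := by
    rw [Complex.div_natCast_im]
    exact div_pos z.im_pos (by exact_mod_cast hfpos)
  have hs := summable_pair him (c := fun p => (if (f : ℤ) ∣ p.1 - A then (f : ℂ)⁻¹ else 0) *
    e2pi (p.2 * x)) (B := ‖(f : ℂ)⁻¹‖) (fun p => by
      have : ((p.2 : ℕ) : ℂ) * (x : ℂ) = ((p.2 * x : ℚ) : ℂ) := by push_cast; ring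
      rw [norm_mul, this, norm_e2pi_ratCast, mul_one]
      split_ifs
      · rfl
      · simp)
  rw [hs.tsum_prod, heckeP]
  let S : Set ℕ+ := {n | (f : ℤ) ∣ n - A}
  let φ : S → {k : ℚ // 0 < k ∧ ∃ n : ℤ, k = (A : ℚ) / f + n} := fun n =>
    ⟨(n.1 : ℚ) / f, by have := n.1.pos; positivity, by
      obtain ⟨k, hk⟩ := n.2
      refine ⟨k, ?_⟩
      have : ((n.1 : ℕ) : ℚ) - A = f * k := by exact_mod_cast hk
      field_simp
      linarith⟩
  have hφ : Function.Bijective φ := by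
    constructor
    · intro m n h
      have h1 : ((m.1 : ℕ) : ℚ) / f = (n.1 : ℕ) / f := congrArg Subtype.val h
      rw [div_left_inj' hfpos.ne'] at h1
      exact Subtype.ext (PNat.coe_injective (by exact_mod_cast h1))
    · rintro ⟨k, hk, n, hn⟩
      have h1 : k * f = ((A + f * n : ℤ) : ℚ) := by
        rw [hn]; push_cast; field_simp
      have h2 : 0 < A + f * n := by
        have : (0 : ℚ) < ((A + f * n : ℤ) : ℚ) := by rw [← h1]; positivity
        exact_mod_cast this
      have h3 : (((A + f * n).toNat : ℕ) : ℤ) = A + f * n := Int.toNat_of_nonneg h2.le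
      refine ⟨⟨⟨(A + f * n).toNat, by omega⟩, ?_⟩, ?_⟩
      · change (f : ℤ) ∣ (((A + f * n).toNat : ℕ) : ℤ) - A
        rw [h3]; exact ⟨n, by ring⟩
      · refine Subtype.ext ?_
        change (((A + f * n).toNat : ℕ) : ℚ) / f = k
        rw [div_eq_iff hfpos.ne', h1, ← h3]
        rfl
  rw [← (Equiv.ofBijective φ hφ).tsum_eq, ← tsum_subtype_eq_of_support_subset (s := S)]
  · refine tsum_congr fun n => ?_
    rw [← tsum_mul_left]
    refine tsum_congr fun m => ?_
    have hn : (f : ℤ) ∣ (n.1 : ℕ) - A := n.2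
    rw [if_pos hn]
    have he : Complex.exp (2 * Real.pi * Complex.I * (m : ℂ) *
        ((((Equiv.ofBijective φ hφ) n : ℚ) : ℂ) * (z : ℂ) + (x : ℂ))) =
        e2pi (m * x) * e2pi (n.1 * m * (z / f)) := by
      rw [← e2pi_add, e2pi]
      congr 1
      change 2 * Real.pi * Complex.I * (m : ℂ) *
        (((((n.1 : ℕ) : ℚ) / f : ℚ) : ℂ) * (z : ℂ) + (x : ℂ)) = _
      push_cast
      ring
    rw [he]
    change (((((n.1 : ℕ) : ℚ) / f : ℚ) : ℂ)) * _ = _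
    push_cast
    ring
  · intro n hn
    by_contra h
    apply hn
    have h' : ¬ (f : ℤ) ∣ (n : ℕ) - A := h
    simp [h']

end QuadraticEisenstein

end

/-! ### Fourier expansions, and the identification of `E_ψ` with a twist -/

noncomputable section

namespace QuadraticEisenstein

open UpperHalfPlane Filter Topology EisensteinSeries

section

variable {f : ℕ} [NeZero f]

/-- The series `∑_{n, m ≥ 1} ψ(n) ψ(m) n e(nmz)`. -/
def charSeries (ψ : DirichletCharacter ℂ f) (z : ℍ) : ℂ :=
  ∑' p : ℕ+ × ℕ+, (ψ (p.1 : ℕ) * ψ (p.2 : ℕ)) * ((p.1 : ℂ) * e2pi (p.1 * p.2 * z))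

theorem sum_units_char_ite (ψ : DirichletCharacter ℂ f) {ε : ℤ} (hε : ε * ε = 1) (n : ℤ) (c : ℂ) :
    ∑ a : (ZMod f)ˣ, ψ (a : ZMod f) * (if (f : ℤ) ∣ n - ε * (a : ZMod f).val then c else 0) =
      ψ ((ε * n : ℤ) : ZMod f) * c := by
  classical
  rw [sum_units_eq_sum (fun a : ZMod f => ψ a * (if (f : ℤ) ∣ n - ε * a.val then c else 0))
    (fun a ha => by rw [MulChar.map_nonunit _ ha, zero_mul])]
  have hiff : ∀ a : ZMod f, (f : ℤ) ∣ n - ε * a.val ↔ a = ((ε * n : ℤ) : ZMod f) := fun a => by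
    have h1 : (ε : ZMod f) * ε = 1 := by exact_mod_cast congrArg (Int.cast : ℤ → ZMod f) hε
    rw [← ZMod.intCast_zmod_eq_zero_iff_dvd]
    push_cast
    rw [ZMod.natCast_zmod_val]
    constructor
    · intro h; linear_combination -(ε : ZMod f) * h - a * h1
    · rintro rfl; linear_combination -(n : ZMod f) * h1
  simp_rw [hiff, mul_ite, mul_zero]
  rw [Finset.sum_ite_eq' Finset.univ]
  simp

/-- The sign `ε = ±1` treats `P_x` and `P_{-x}` together: it enters once through `a` and once
through `b`, and `ψ(ε)² = 1`. -/
theorem sum_char_mul_heckeP {ψ : DirichletCharacter ℂ f} (hprim : ψ.IsPrimitive)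
    (hquad : ψ.IsQuadratic) {ε : ℤ} (hε : ε * ε = 1) (z : ℍ) :
    ∑ a : (ZMod f)ˣ, ∑ b : (ZMod (f ^ 2))ˣ,
      ψ (a : ZMod f) * ψ (((b : ZMod (f ^ 2)).val : ℕ) : ZMod f) *
        heckeP (((ε * (a : ZMod f).val : ℤ) : ℚ) / f)
          (((ε * (b : ZMod (f ^ 2)).val : ℤ) : ℚ) / (f : ℚ) ^ 2) z =
      gaussG ψ * charSeries ψ z := by
  have hfC : (f : ℂ) ≠ 0 := by exact_mod_cast NeZero.ne f
  have him : 0 < ((z : ℂ) / f).im := by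
    rw [Complex.div_natCast_im]
    exact div_pos z.im_pos (by exact_mod_cast Nat.pos_of_ne_zero (NeZero.ne f))
  have hsum : ∀ (A : ℤ) (x : ℚ) (c : ℂ), Summable fun p : ℕ+ × ℕ+ => c *
      (((if (f : ℤ) ∣ p.1 - A then (f : ℂ)⁻¹ else 0) * e2pi (p.2 * x)) *
        ((p.1 : ℂ) * e2pi (p.1 * p.2 * (z / f)))) := fun A x c =>
    (summable_pair him (B := ‖(f : ℂ)⁻¹‖) (fun p => by
      have : ((p.2 : ℕ) : ℂ) * (x : ℂ) = ((p.2 * x : ℚ) : ℂ) := by push_cast; ring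
      rw [norm_mul, this, norm_e2pi_ratCast, mul_one]
      split_ifs
      · rfl
      · simp)).mul_left c
  simp_rw [heckeP_eq_tsum, ← tsum_mul_left]
  simp_rw [← Summable.tsum_finsetSum (fun b _ => hsum _ _ _)]
  rw [← Summable.tsum_finsetSum (fun a _ => summable_sum fun b _ => hsum _ _ _)]
  have hterm : ∀ p : ℕ+ × ℕ+, ∑ a : (ZMod f)ˣ, ∑ b : (ZMod (f ^ 2))ˣ,
      ψ (a : ZMod f) * ψ (((b : ZMod (f ^ 2)).val : ℕ) : ZMod f) *
      (((if (f : ℤ) ∣ p.1 - ε * (a : ZMod f).val then (f : ℂ)⁻¹ else 0) *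
        e2pi (p.2 * ((((ε * (b : ZMod (f ^ 2)).val : ℤ) : ℚ) / (f : ℚ) ^ 2 : ℚ) : ℂ))) *
        ((p.1 : ℂ) * e2pi (p.1 * p.2 * (z / f)))) =
      ((ψ ((ε * (p.1 : ℕ) : ℤ) : ZMod f) * (f : ℂ)⁻¹) * (if (f : ℤ) ∣ ε * (p.2 : ℕ) then
        f * (ψ ((ε * (p.2 : ℕ) / f : ℤ) : ZMod f) * gaussG ψ) else 0)) *
        ((p.1 : ℂ) * e2pi (p.1 * p.2 * (z / f))) := fun p => by
    rw [← sum_units_sq_char_mul_e2pi hprim hquad, ← sum_units_char_ite ψ hε,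
      Finset.sum_mul_sum, Finset.sum_mul]
    refine Finset.sum_congr rfl fun a _ => ?_
    rw [Finset.sum_mul]
    refine Finset.sum_congr rfl fun b _ => ?_
    have : ((p.2 : ℕ) : ℂ) * ((((ε * (b : ZMod (f ^ 2)).val : ℤ) : ℚ) / (f : ℚ) ^ 2 : ℚ) : ℂ) =
        ((ε * (p.2 : ℕ) : ℤ) : ℂ) * ((b : ZMod (f ^ 2)).val / (f : ℂ) ^ 2) := by
      push_cast; ring
    rw [this]
    ring
  simp_rw [hterm]
  have hε' : ε ≠ 0 := by rintro rfl; simp at hε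
  -- The sum over `b` vanishes unless `f ∣ m`. The substitution `m = f m'` turns `z/f` back into
  -- `z`.
  obtain ⟨F, hF⟩ : ∃ F : ℕ+, (F : ℕ) = f := ⟨⟨f, Nat.pos_of_ne_zero (NeZero.ne f)⟩, rfl⟩
  let i : ℕ+ × ℕ+ → ℕ+ × ℕ+ := fun p => (p.1, F * p.2)
  have hi : Function.Injective i := by
    rintro ⟨a, b⟩ ⟨c, d⟩ h
    simp only [i, Prod.mk.injEq, mul_right_inj] at h
    exact Prod.ext h.1 h.2
  rw [← hi.tsum_eq]
  · rw [charSeries, ← tsum_mul_left]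
    refine tsum_congr fun p => ?_
    have hp2 : (((i p).2 : ℕ) : ℤ) = f * (p.2 : ℕ) := by simp [i, hF]
    have hp2C : (((i p).2 : ℕ) : ℂ) = f * (p.2 : ℕ) := by simp [i, hF]
    have hp1 : (i p).1 = p.1 := rfl
    rw [hp2, hp2C, hp1, if_pos ⟨ε * (p.2 : ℕ), by ring⟩,
      show ε * ((f : ℤ) * (p.2 : ℕ)) / f = ε * (p.2 : ℕ) by
        rw [mul_left_comm]
        exact Int.mul_ediv_cancel_left _ (by exact_mod_cast NeZero.ne f)]
    have hψ : ψ (ε : ZMod f) * ψ (ε : ZMod f) = 1 := by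
      rw [← map_mul]
      have : (ε : ZMod f) * ε = 1 := by exact_mod_cast congrArg (Int.cast : ℤ → ZMod f) hε
      rw [this, map_one]
    have he : ((p.1 : ℕ) : ℂ) * (f * (p.2 : ℕ)) * (z / f) = p.1 * p.2 * z := by
      field_simp
    rw [he]
    push_cast
    rw [map_mul, map_mul]
    field_simp
    linear_combination (ψ (p.1 : ℕ) * ψ (p.2 : ℕ) * gaussG ψ * e2pi (p.1 * p.2 * z)) * hψ
  · intro p hp
    by_contra h
    apply hp
    have hnd : ¬ (f : ℤ) ∣ ε * (p.2 : ℕ) := by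
      intro hd
      have hd' : (f : ℤ) ∣ (p.2 : ℕ) := by
        have := hd.mul_left ε
        rwa [← mul_assoc, hε, one_mul] at this
      obtain ⟨k, hk⟩ := Int.natCast_dvd_natCast.mp hd'
      have hk0 : 0 < k := by
        rcases Nat.eq_zero_or_pos k with rfl | h
        · have := p.2.pos; omega
        · exact h
      exact h ⟨(p.1, ⟨k, hk0⟩), Prod.ext rfl (PNat.eq (by rw [hk, ← hF]; rfl))⟩
    beta_reduce
    rw [if_neg hnd, mul_zero, zero_mul]

end

theorem starE2_eq_tsum (z : ℍ) : starE2 z = -(1 / 24) + 1 / (8 * Real.pi * (z.im : ℂ)) +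
    ∑' p : ℕ+ × ℕ+, (p.1 : ℂ) * e2pi (p.1 * p.2 * z) := by
  have hr := norm_e2pi_lt_one z.im_pos
  have h := tsum_prod_pow_eq_tsum_sigma 1 hr
  rw [← (summable_prod_mul_pow 1 hr).tsum_prod (f := fun c : ℕ+ × ℕ+ =>
    ((c.2 : ℕ) : ℂ) ^ 1 * (e2pi z ^ (c.1 * c.2 : ℕ))),
    ← (Equiv.prodComm ℕ+ ℕ+).tsum_eq] at h
  have h2 : ∑' p : ℕ+ × ℕ+, (p.1 : ℂ) * e2pi (p.1 * p.2 * z) =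
      ∑' e : ℕ+, (ArithmeticFunction.sigma 1 e : ℂ) * e2pi z ^ (e : ℕ) := by
    rw [← h]
    refine tsum_congr fun p => ?_
    rw [← Nat.cast_mul, e2pi_natCast_mul]
    simp [mul_comm]
  rw [starE2, E2_eq_tsum_cexp, h2]
  have h3 : ∑' e : ℕ+, (ArithmeticFunction.sigma 1 e : ℂ) * e2pi z ^ (e : ℕ) =
    ∑' n : ℕ+, (ArithmeticFunction.sigma 1 n : ℂ) *
      Complex.exp (2 * Real.pi * Complex.I * z) ^ (n : ℕ) := rfl
  rw [h3]
  ring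

section

variable {f : ℕ} [NeZero f]

theorem shiftE2_apply (u : ZMod f) (z : ℍ) :
    shiftE2 u z = -(1 / 24) + 1 / (8 * Real.pi * (z.im : ℂ)) +
      ∑' p : ℕ+ × ℕ+, e2pi ((p.1 * p.2 : ℕ) * (u.val / f)) *
        ((p.1 : ℂ) * e2pi (p.1 * p.2 * z)) := by
  have hfC : (f : ℂ) ≠ 0 := by exact_mod_cast NeZero.ne f
  have hc := coe_upperGL_smul f f u.val (NeZero.ne f) (NeZero.ne f) z
  have him : (upperGL f f u.val (NeZero.ne f) (NeZero.ne f) • z : ℍ).im = z.im := by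
    rw [← coe_im, hc]
    have : ((f : ℂ) * z + ((u.val : ℤ) : ℂ)) / f = z + ((u.val / f : ℝ) : ℂ) := by
      push_cast; field_simp
    rw [this, Complex.add_im, Complex.ofReal_im, add_zero, coe_im]
  rw [shiftE2, slash_upperGL, div_self hfC, one_mul, starE2_eq_tsum, him, hc]
  congr 1
  refine tsum_congr fun p => ?_
  have : ((p.1 : ℕ) : ℂ) * (p.2 : ℕ) * (((f : ℂ) * z + ((u.val : ℤ) : ℂ)) / f) =
      (p.1 * p.2 : ℕ) * (u.val / f) + p.1 * p.2 * z := by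
    push_cast; field_simp; ring
  rw [this, e2pi_add]
  ring

theorem twistE2_apply {ψ : DirichletCharacter ℂ f} (hprim : ψ.IsPrimitive)
    (hquad : ψ.IsQuadratic) (z : ℍ) :
    twistE2 ψ z = 1 / gaussG ψ * ((∑ u : ZMod f, ψ u) *
      (-(1 / 24) + 1 / (8 * Real.pi * (z.im : ℂ))) + gaussG ψ * charSeries ψ z) := by
  have hsum : ∀ u : ZMod f, Summable fun p : ℕ+ × ℕ+ => ψ u *
      (e2pi ((p.1 * p.2 : ℕ) * (u.val / f)) * ((p.1 : ℂ) * e2pi (p.1 * p.2 * z))) := fun u =>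
    (summable_pair z.im_pos (B := 1) (fun p => by
      have : ((p.1 * p.2 : ℕ) : ℂ) * (u.val / f) = (((p.1 * p.2 : ℕ) * (u.val / f) : ℚ) : ℂ) := by
        push_cast; rfl
      rw [this, norm_e2pi_ratCast])).mul_left (ψ u)
  rw [twistE2, Pi.smul_apply, Finset.sum_apply, smul_eq_mul]
  congr 1
  simp_rw [Pi.smul_apply, smul_eq_mul, shiftE2_apply, mul_add (ψ _), Finset.sum_add_distrib,
    ← tsum_mul_left]
  rw [← Summable.tsum_finsetSum (fun u _ => hsum u), Finset.sum_mul, ← Finset.sum_add_distrib,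
    charSeries, ← tsum_mul_left]
  congr 1
  · exact Finset.sum_congr rfl fun u _ => by ring
  · refine tsum_congr fun p => ?_
    simp_rw [← mul_assoc (ψ _)]
    rw [← Finset.sum_mul]
    have := sum_char_mul_e2pi hprim hquad ((p.1 * p.2 : ℕ) : ℤ)
    simp only [Int.cast_natCast] at this
    rw [this, Nat.cast_mul, map_mul]
    ring

theorem ne_one_of_isPrimitive {ψ : DirichletCharacter ℂ f} (hprim : ψ.IsPrimitive) (hf : f ≠ 1) :
    ψ ≠ 1 := by
  rintro rfl
  rw [DirichletCharacter.isPrimitive_def, DirichletCharacter.conductor_one] at hprim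
  exact hf hprim.symm

theorem sum_char_eq_zero {ψ : DirichletCharacter ℂ f} (hprim : ψ.IsPrimitive) (hf : f ≠ 1) :
    ∑ u : ZMod f, ψ u = 0 :=
  MulChar.sum_eq_zero_of_ne_one (ne_one_of_isPrimitive hprim hf)

theorem sum_units_sq_char {ψ : DirichletCharacter ℂ f} (hprim : ψ.IsPrimitive)
    (hquad : ψ.IsQuadratic) (hf : f ≠ 1) :
    ∑ b : (ZMod (f ^ 2))ˣ, ψ (((b : ZMod (f ^ 2)).val : ℕ) : ZMod f) = 0 := by
  have h := sum_units_sq_char_mul_e2pi hprim hquad 0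
  have h0 : ∀ x : ℂ, e2pi (((0 : ℤ) : ℂ) * x) = 1 := fun x => by
    rw [Int.cast_zero, zero_mul, ← Int.cast_zero, e2pi_intCast]
  simp_rw [h0, mul_one] at h
  rw [h, if_pos (dvd_zero _), Int.zero_ediv, Int.cast_zero,
    DirichletCharacter.map_zero' _ hf, zero_mul, mul_zero]

theorem eisPsi_eq_twistE2 {ψ : DirichletCharacter ℂ f} (hprim : ψ.IsPrimitive)
    (hquad : ψ.IsQuadratic) : eisPsi ψ = twistE2 ψ := by
  funext z
  have hP := sum_char_mul_heckeP hprim hquad (ε := 1) (by norm_num) z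
  have hN := sum_char_mul_heckeP hprim hquad (ε := -1) (by norm_num) z
  have hcast : ∀ n d : ℕ, (((-1 * n : ℤ) : ℚ) / d) = -((n : ℚ) / d) := fun n d => by
    push_cast; ring
  have hcast2 : ∀ n d : ℕ, (((-1 * n : ℤ) : ℚ) / (d : ℚ) ^ 2) = -((n : ℚ) / (d : ℚ) ^ 2) :=
    fun n d => by push_cast; ring
  simp_rw [hcast, hcast2] at hN
  simp only [one_mul, Int.cast_natCast] at hP
  have hK : ∑ a : (ZMod f)ˣ, ∑ b : (ZMod (f ^ 2))ˣ,
      ψ (a : ZMod f) * ψ (((b : ZMod (f ^ 2)).val : ℕ) : ZMod f) *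
      (((B2 (((a : ZMod f).val : ℚ) / f) : ℚ) : ℂ) / 2 -
        (if Int.fract (((a : ZMod f).val : ℚ) / f) = 0 ∧
          Int.fract (((b : ZMod (f ^ 2)).val : ℚ) / (f : ℚ) ^ 2) = 0 then
        Complex.I / (2 * Real.pi * ((z : ℂ) - (starRingEnd ℂ) (z : ℂ))) else 0)) =
      (∑ u : ZMod f, ψ u) * (1 / 12 - 1 / (4 * Real.pi * (z.im : ℂ))) := by
    -- Only for `f = 1` do the Bernoulli constant `B₂(0)/2 = 1/12` and the non-holomorphic term
    -- survive.
    by_cases hf : f = 1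
    · subst hf
      have h1 : ∀ x : ZMod 1, x.val = 0 := fun x => by
        have := ZMod.val_lt x; omega
      have h3 : ψ = 1 := DirichletCharacter.level_one ψ
      have : Subsingleton (ZMod (1 ^ 2)) := by rw [one_pow]; infer_instance
      have hz : (z : ℂ) - (starRingEnd ℂ) (z : ℂ) = 2 * Complex.I * z.im := by
        apply Complex.ext <;> simp; ring
      simp_rw [h1]
      subst h3
      rw [hz]
      have hpi : (Real.pi : ℂ) ≠ 0 := by exact_mod_cast Real.pi_ne_zero
      have hzi : ((z.im : ℝ) : ℂ) ≠ 0 := by exact_mod_cast z.im_ne_zero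
      have hone : ∀ x : ZMod 1, (1 : DirichletCharacter ℂ 1) x = 1 := fun x =>
        MulChar.one_apply (isUnit_of_subsingleton x)
      simp [hone, B2]
      field_simp
      ring
    · rw [sum_char_eq_zero hprim hf, zero_mul]
      have hfr : ∀ a : (ZMod f)ˣ, Int.fract (((a : ZMod f).val : ℚ) / f) ≠ 0 := fun a h => by
        have hlt : ((a : ZMod f).val : ℚ) < f := by exact_mod_cast ZMod.val_lt (a : ZMod f)
        have hfpos : (0 : ℚ) < f := by exact_mod_cast Nat.pos_of_ne_zero (NeZero.ne f)
        rw [Int.fract_eq_self.mpr ⟨by positivity, (div_lt_one hfpos).mpr hlt⟩, div_eq_zero_iff] at h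
        rcases h with h | h
        · have h0 : (a : ZMod f) = 0 := by
            rw [← ZMod.val_eq_zero]; exact_mod_cast h
          have : Fact (1 < f) := ⟨by have := NeZero.ne f; omega⟩
          exact a.ne_zero h0
        · exact hfpos.ne' h
      -- The Bernoulli term does not depend on `b`, and `ψ` sums to zero over `b`.
      refine Finset.sum_eq_zero fun a _ => ?_
      simp_rw [hfr a, false_and, if_false, sub_zero]
      rw [← Finset.sum_mul, ← Finset.mul_sum, sum_units_sq_char hprim hquad hf]
      ring
  rw [twistE2_apply hprim hquad, eisPsi]
  have hsplit : ∑ a : (ZMod f)ˣ, ∑ b : (ZMod (f ^ 2))ˣ,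
      ψ (a : ZMod f) * ψ (((b : ZMod (f ^ 2)).val : ℕ) : ZMod f) *
        heckePhi (((a : ZMod f).val : ℚ) / (f : ℚ)) (((b : ZMod (f ^ 2)).val : ℚ) / (f : ℚ) ^ 2) z
      = (∑ u : ZMod f, ψ u) * (1 / 12 - 1 / (4 * Real.pi * (z.im : ℂ))) -
        2 * (gaussG ψ * charSeries ψ z) := by
    rw [two_mul, ← hK, ← sub_sub]
    nth_rw 1 [← hP]
    rw [← hN, ← Finset.sum_sub_distrib, ← Finset.sum_sub_distrib]
    refine Finset.sum_congr rfl fun a _ => ?_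
    rw [← Finset.sum_sub_distrib, ← Finset.sum_sub_distrib]
    refine Finset.sum_congr rfl fun b _ => ?_
    rw [heckePhi]
    ring
  rw [hsplit]
  ring

end

end QuadraticEisenstein

end

noncomputable section

namespace QuadraticEisenstein

/-! ### The constant terms of the twist -/

theorem B2_add_intCast (t : ℚ) (n : ℤ) : B2 (t + n) = B2 t := by
  rw [B2, Int.fract_add_intCast, B2]

theorem B2_val_div (n : ℕ) [NeZero n] (x : ℤ) : B2 (((x : ZMod n).val : ℚ) / n) = B2 (x / n) := by
  have hn : (n : ℚ) ≠ 0 := by exact_mod_cast NeZero.ne n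
  have h : (((x : ZMod n).val : ℤ) : ℤ) = x % n := ZMod.val_intCast x
  have h2 : (x : ℚ) = ((x : ZMod n).val : ℚ) + n * ((x / n : ℤ) : ℚ) := by
    have := Int.emod_add_mul_ediv x n
    rw [← h] at this
    exact_mod_cast this.symm
  have h3 : (x : ℚ) / n = ((x : ZMod n).val : ℚ) / n + ((x / n : ℤ) : ℚ) := by
    rw [div_add' _ _ _ hn, div_left_inj' hn]; linarith
  rw [h3, B2_add_intCast]

theorem sum_range_B2 (n : ℕ) (hn : n ≠ 0) :
    ∑ c ∈ Finset.range n, B2 ((c : ℚ) / n) = 1 / (6 * n) := by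
  have hnQ : (n : ℚ) ≠ 0 := by exact_mod_cast hn
  have hpos : (0 : ℚ) < n := by exact_mod_cast Nat.pos_of_ne_zero hn
  have h1 : ∀ c ∈ Finset.range n, B2 ((c : ℚ) / n) = (c : ℚ) ^ 2 / n ^ 2 - c / n + 1 / 6 :=
    fun c hc => by
      have hlt : (c : ℚ) < n := by exact_mod_cast Finset.mem_range.mp hc
      rw [B2, Int.fract_eq_self.mpr ⟨by positivity, (div_lt_one hpos).mpr hlt⟩, div_pow]
  -- The range `k` is decoupled from the denominator `n` so that induction applies.
  have h2 : ∀ k : ℕ, ∑ c ∈ Finset.range k, ((c : ℚ) ^ 2 / n ^ 2 - c / n + 1 / 6) =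
      (k : ℚ) * (k - 1) * (2 * k - 1) / (6 * n ^ 2) - k * (k - 1) / (2 * n) + k / 6 := fun k => by
    induction k with
    | zero => simp
    | succ k ih =>
      rw [Finset.sum_range_succ, ih]
      push_cast
      field_simp
      ring
  rw [Finset.sum_congr rfl h1, h2]
  field_simp
  ring

/-- The distribution relation of the second Bernoulli polynomial. -/
theorem sum_B2_mul (f : ℕ) [NeZero f] (v : ℕ) :
    ∑ a : ZMod f, B2 ((a.val : ℚ) * v / f) = (Nat.gcd v f : ℚ) ^ 2 / (6 * f) := by
  rw [sum_zmod_val f (fun a => B2 ((a : ℚ) * v / f))]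
  have hf : f ≠ 0 := NeZero.ne f
  obtain ⟨v', hv'⟩ := Nat.gcd_dvd_left v f
  obtain ⟨n, hn⟩ := Nat.gcd_dvd_right v f
  set g := Nat.gcd v f with hg
  have hg0 : g ≠ 0 := fun h => hf (by rw [hn, h, zero_mul])
  have hn0 : n ≠ 0 := fun h => hf (by rw [hn, h, mul_zero])
  have : NeZero n := ⟨hn0⟩
  have hcop : Nat.Coprime v' n := by
    have : g * Nat.gcd v' n = g * 1 := by
      rw [← Nat.gcd_mul_left, ← hv', ← hn, mul_one]
    exact Nat.eq_of_mul_eq_mul_left (Nat.pos_of_ne_zero hg0) this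
  have hgQ : (g : ℚ) ≠ 0 := by exact_mod_cast hg0
  have hnQ : (n : ℚ) ≠ 0 := by exact_mod_cast hn0
  have hper : ∀ j u : ℕ, B2 (((u + n * j : ℕ) : ℚ) * v / f) = B2 ((u * v' : ℕ) / n) := fun j u => by
    have : (((u + n * j : ℕ) : ℚ) * v / f) = ((u * v' : ℕ) : ℚ) / n + ((j * v' : ℕ) : ℤ) := by
      rw [hv', hn]; push_cast; field_simp
    rw [this, B2_add_intCast]
  have hmul : ∑ u ∈ Finset.range n, B2 ((u * v' : ℕ) / n) = 1 / (6 * n) := by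
    rw [← sum_range_B2 n hn0, ← sum_zmod_val n (fun u => B2 ((u * v' : ℕ) / n)),
      ← sum_zmod_val n (fun u => B2 ((u : ℕ) / n))]
    have hu : IsUnit (v' : ZMod n) := (ZMod.isUnit_iff_coprime v' n).mpr hcop
    refine Fintype.sum_bijective (fun u => u * (v' : ZMod n))
      (IsUnit.isUnit_iff_mulRight_bijective.mp hu) _ _ fun u => ?_
    have h1 : u * (v' : ZMod n) = (((u.val * v' : ℕ) : ℤ) : ZMod n) := by
      push_cast; rw [ZMod.natCast_zmod_val]
    rw [h1, B2_val_div]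
    rfl
  rw [show Finset.range f = Finset.range (n * g) by rw [mul_comm, ← hn], sum_range_mul]
  simp_rw [hper, hmul]
  rw [Finset.sum_const, Finset.card_range, nsmul_eq_mul, hn]
  push_cast
  field_simp

section

variable {f : ℕ} [NeZero f]

/-- A primitive character is orthogonal to functions of a proper divisor of its modulus. -/
theorem sum_char_mul_eq_zero_of_periodic {ψ : DirichletCharacter ℂ f} (hprim : ψ.IsPrimitive)
    {d : ℕ} (hd : d ∣ f) (hdf : d ≠ f) (F : ZMod f → ℂ) (G : ℤ → ℂ)
    (hG : ∀ x k, G (x + d * k) = G x) (hF : ∀ u, IsUnit u → F u = G u.val) :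
    ∑ u : ZMod f, ψ u * F u = 0 := by
  have : NeZero d := ⟨fun h => NeZero.ne f (by rw [h] at hd; exact zero_dvd_iff.mp hd)⟩
  have hnot : ¬ ψ.FactorsThrough d := fun h => by
    have h1 := ψ.conductor_dvd_of_mem_conductorSet (ψ.mem_conductorSet_iff.mpr h)
    rw [(DirichletCharacter.isPrimitive_def ψ).mp hprim] at h1
    exact hdf (Nat.dvd_antisymm hd h1)
  -- As `ψ` does not factor through `d`, some unit `x ≡ 1` modulo `d` has `ψ(x) ≠ 1`. Multiplication
  -- by `x` preserves `G` and scales the sum by `ψ(x)`, so the sum is zero.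
  rw [DirichletCharacter.factorsThrough_iff_ker_unitsMap hd, SetLike.not_le_iff_exists] at hnot
  obtain ⟨x, hx, hψx⟩ := hnot
  have hψx' : ψ x ≠ 1 := fun h => hψx (by
    rw [MonoidHom.mem_ker]; ext; simpa using h)
  have hxu : ∀ u : ZMod f, G (x * u).val = G u.val := fun u => by
    have h1 : ZMod.castHom hd (ZMod d) x = 1 := by
      have := congrArg Units.val ((MonoidHom.mem_ker).mp hx)
      simpa [ZMod.unitsMap] using this
    have h2 : (((x * u).val : ℤ) : ZMod d) = ((u.val : ℤ) : ZMod d) := by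
      have h3 : ∀ w : ZMod f, ((w.val : ℤ) : ZMod d) = ZMod.castHom hd (ZMod d) w := fun w => by
        conv_rhs => rw [← ZMod.natCast_zmod_val w]
        simp
      rw [h3, h3, map_mul, h1, one_mul]
    rw [ZMod.intCast_eq_intCast_iff_dvd_sub] at h2
    obtain ⟨k, hk⟩ := h2
    have h4 : (u.val : ℤ) = (x * u).val + d * k := by linarith
    rw [h4, hG]
  have hsum : ∑ u : ZMod f, ψ u * F u = ∑ u : ZMod f, ψ u * G u.val :=
    Finset.sum_congr rfl fun u _ => by
      by_cases hu : IsUnit u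
      · rw [hF u hu]
      · rw [MulChar.map_nonunit _ hu, zero_mul, zero_mul]
  rw [hsum]
  have hshift : ∑ u : ZMod f, ψ u * G u.val = ψ x * ∑ u : ZMod f, ψ u * G u.val := by
    rw [Finset.mul_sum]
    symm
    refine Fintype.sum_bijective (fun u => (x : ZMod f) * u) (Units.mulLeft_bijective x) _ _
      fun u => ?_
    rw [map_mul, hxu, mul_assoc]
  have : (1 - ψ x) * ∑ u : ZMod f, ψ u * G u.val = 0 := by
    rw [sub_mul, one_mul, ← hshift, sub_self]
  rcases mul_eq_zero.mp this with h | h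
  · exact absurd (sub_eq_zero.mp h).symm hψx'
  · exact h

/-- The sum `∑_v ψ(v - 1) gcd(v, f)²`. -/
def gcdSum (ψ : DirichletCharacter ℂ f) : ℂ :=
  ∑ t : ZMod f, ψ t * (Int.gcd (1 + t.val) f : ℂ) ^ 2

/-- For a unit `a`, substituting `b = at` gives `ψ(a)ψ(b) = ψ(t)` and the argument `a(1 + t)/f`. For
a non-unit `a` the original row is zero, and so is the substituted one, since it is periodic in `t`
modulo the proper divisor `f / gcd(a, f)`. The sum over all `a` is then evaluated by `sum_B2_mul`.
-/
theorem nPsi_eq {ψ : DirichletCharacter ℂ f} (hprim : ψ.IsPrimitive) (hquad : ψ.IsQuadratic) :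
    nPsi ψ = -(1 / 24) / gaussG ψ * gcdSum ψ := by
  have hfC : (f : ℂ) ≠ 0 := by exact_mod_cast NeZero.ne f
  have hfQ : (f : ℚ) ≠ 0 := by exact_mod_cast NeZero.ne f
  have hrow : ∀ a : ZMod f, ∑ b : ZMod f,
      ψ a * ψ b * ((B2 (((a.val : ℚ) + (b.val : ℚ)) / (f : ℚ)) : ℚ) : ℂ) =
      ∑ t : ZMod f, ψ t * ((B2 ((a.val : ℚ) * ((1 + t.val : ℕ) : ℚ) / f) : ℚ) : ℂ) := fun a => by
    by_cases ha : IsUnit a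
    · symm
      refine Fintype.sum_bijective (fun t => a * t)
        (IsUnit.isUnit_iff_mulLeft_bijective.mp ha) _ _ fun t => ?_
      have h1 : B2 ((a.val : ℚ) * ((1 + t.val : ℕ) : ℚ) / f) =
          B2 (((a.val : ℚ) + ((a * t).val : ℚ)) / f) := by
        have e1 : a * t = ((a.val * t.val : ℤ) : ZMod f) := by
          push_cast; rw [ZMod.natCast_zmod_val, ZMod.natCast_zmod_val]
        have e2 := B2_val_div f (a.val + (a * t).val : ℤ)
        have e3 := B2_val_div f (a.val * ((1 + t.val : ℕ) : ℤ) : ℤ)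
        have e4 : ((a.val + (a * t).val : ℤ) : ZMod f) =
            ((a.val * ((1 + t.val : ℕ) : ℤ) : ℤ) : ZMod f) := by
          push_cast; simp only [ZMod.natCast_zmod_val]; ring
        rw [e4, e3] at e2
        push_cast at e2 ⊢
        exact e2
      rw [h1, map_mul, ← mul_assoc, ← pow_two, sq_eq_one_of_isQuadratic hquad ha, one_mul]
    · have hL : ∑ b : ZMod f,
          ψ a * ψ b * ((B2 (((a.val : ℚ) + (b.val : ℚ)) / (f : ℚ)) : ℚ) : ℂ) = 0 :=
        Finset.sum_eq_zero fun b _ => by rw [MulChar.map_nonunit _ ha, zero_mul, zero_mul]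
      rw [hL]
      symm
      obtain ⟨d, hd⟩ := Nat.gcd_dvd_right a.val f
      obtain ⟨a', ha'⟩ := Nat.gcd_dvd_left a.val f
      have hg0 : Nat.gcd a.val f ≠ 0 := fun h => NeZero.ne f (by rw [h, zero_mul] at hd; exact hd)
      have hd0 : d ≠ 0 := fun h => NeZero.ne f (by rw [h, mul_zero] at hd; exact hd)
      have hg1 : Nat.gcd a.val f ≠ 1 := fun h => ha (by
        rw [← ZMod.natCast_zmod_val a]; exact (ZMod.isUnit_iff_coprime _ _).mpr h)
      refine sum_char_mul_eq_zero_of_periodic hprim (d := d) ⟨Nat.gcd a.val f, by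
        rw [mul_comm]; exact hd⟩ (fun h => hg1 ?_) _
        (fun x => ((B2 ((a.val : ℚ) * (1 + x) / f) : ℚ) : ℂ)) (fun x k => ?_) (fun u _ => ?_)
      · rw [h] at hd
        exact Nat.eq_of_mul_eq_mul_right (Nat.pos_of_ne_zero (NeZero.ne f))
          (by rw [one_mul]; exact hd.symm)
      · have hgQ : ((Nat.gcd a.val f : ℕ) : ℚ) ≠ 0 := by exact_mod_cast hg0
        have hdQ : (d : ℚ) ≠ 0 := by exact_mod_cast hd0
        have hfd : (f : ℚ) = Nat.gcd a.val f * d := by exact_mod_cast hd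
        have haa : (a.val : ℚ) = Nat.gcd a.val f * a' := by exact_mod_cast ha'
        have : (a.val : ℚ) * (1 + ((x + d * k : ℤ) : ℚ)) / f =
            (a.val : ℚ) * (1 + x) / f + ((a' * k : ℤ) : ℚ) := by
          rw [div_add' _ _ _ hfQ, div_left_inj' hfQ]
          push_cast
          linear_combination (d * k : ℚ) * haa - (a' * k : ℚ) * hfd
        rw [this, B2_add_intCast]
      · push_cast; rfl
  rw [nPsi]
  simp_rw [hrow]
  rw [Finset.sum_comm]
  simp_rw [← Finset.mul_sum, ← Rat.cast_sum, sum_B2_mul]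
  have hg : ∀ t : ZMod f, ((((Nat.gcd (1 + t.val) f : ℕ) : ℚ) ^ 2 / (6 * f) : ℚ) : ℂ) =
      (Int.gcd (1 + t.val) f : ℂ) ^ 2 * (1 / (6 * f)) := fun t => by
    have : Int.gcd (1 + t.val) f = Nat.gcd (1 + t.val) f := by
      rw [← Int.gcd_natCast_natCast]; push_cast; rfl
    rw [this]; push_cast; ring
  simp_rw [hg, ← mul_assoc]
  rw [← Finset.sum_mul, gcdSum]
  by_cases hG : gaussG ψ = 0
  · simp [hG]
  · field_simp
    ring

/-- `ψ(s / f)` if `f ∣ s`, and `0` otherwise. -/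
def charQuot (ψ : DirichletCharacter ℂ f) (s : ℤ) : ℂ :=
  if (f : ℤ) ∣ s then ψ ((s / f : ℤ) : ZMod f) else 0

/-- If `s` is a unit modulo `f`, substitute `u = r s⁻¹ t` and use `gcd(r(1 + t), f) = gcd(1 + t,
f)`. Otherwise the gcd is periodic in `u` modulo the proper divisor `f / gcd(s, f)`, and primitivity
kills the sum. -/
theorem sum_char_mul_gcd_linear {ψ : DirichletCharacter ℂ f} (hprim : ψ.IsPrimitive)
    (hquad : ψ.IsQuadratic) {r : ℤ} (hr : IsCoprime r f) (s : ℤ) :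
    ∑ u : ZMod f, ψ u * (Int.gcd (r + u.val * s) f : ℂ) ^ 2 = ψ r * ψ s * gcdSum ψ := by
  have hru : IsUnit (r : ZMod f) := (ZMod.coe_int_isUnit_iff_isCoprime r f).mpr hr.symm
  have hgcd : ∀ x y : ℤ, (x : ZMod f) = y → Int.gcd x f = Int.gcd y f := fun x y h => by
    rw [ZMod.intCast_eq_intCast_iff_dvd_sub] at h
    obtain ⟨k, hk⟩ := h
    rw [show y = x + f * k by linarith]
    simp
  by_cases hs : IsUnit (s : ZMod f)
  · rw [gcdSum, Finset.mul_sum]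
    symm
    obtain ⟨w, hw⟩ := hs.exists_right_inv
    have hwu : IsUnit w := IsUnit.of_mul_eq_one (s : ZMod f) (by rw [mul_comm]; exact hw)
    refine Fintype.sum_bijective (fun t => ((r : ZMod f) * w) * t)
      (IsUnit.isUnit_iff_mulLeft_bijective.mp (hru.mul hwu)) _ _ fun t => ?_
    have h1 : Int.gcd (r + (((r : ZMod f) * w) * t).val * s) f = Int.gcd (1 + t.val) f := by
      rw [hgcd (r + (((r : ZMod f) * w) * t).val * s) (r * (1 + t.val)) (by
        push_cast
        simp only [ZMod.natCast_zmod_val]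
        linear_combination ((r : ZMod f) * t) * hw)]
      exact Int.gcd_mul_right_left_of_gcd_eq_one (Int.isCoprime_iff_gcd_eq_one.mp hr)
    rw [h1, map_mul, map_mul]
    have h2 : ψ w = ψ s := by
      have h3 : ψ s * ψ w = 1 := by rw [← map_mul, hw, map_one]
      have h4 := sq_eq_one_of_isQuadratic hquad hs
      have h5 : ψ s ≠ 0 := (hs.map ψ).ne_zero
      apply mul_left_cancel₀ h5
      rw [h3, ← h4, pow_two]
    rw [h2]
    ring
  · rw [MulChar.map_nonunit _ hs, mul_zero, zero_mul]
    obtain ⟨d, hd⟩ : (Int.gcd s f) ∣ f := Int.natCast_dvd_natCast.mp (Int.gcd_dvd_right ..)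
    obtain ⟨s', hs'⟩ : (Int.gcd s f : ℤ) ∣ s := Int.gcd_dvd_left ..
    refine sum_char_mul_eq_zero_of_periodic hprim (d := d) ⟨_, by rw [mul_comm]; exact hd⟩
      (fun h => hs ?_) _ (fun x => (Int.gcd (r + x * s) f : ℂ) ^ 2) (fun x k => ?_) (fun u _ => rfl)
    · rw [ZMod.coe_int_isUnit_iff_isCoprime]
      rw [h] at hd
      rw [isCoprime_comm, Int.isCoprime_iff_gcd_eq_one]
      exact Nat.eq_of_mul_eq_mul_right (Nat.pos_of_ne_zero (NeZero.ne f))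
        (by rw [one_mul]; exact hd.symm)
    · have hdz : (f : ℤ) = Int.gcd s f * d := by exact_mod_cast hd
      have : r + (x + d * k) * s = (r + x * s) + f * (k * s') := by
        linear_combination (d * k) * hs' - (k * s') * hdz
      rw [this]
      simp

/-- If `s = fs'`, then `r + us'` is prime to `s'`, so the gcd in `twistValue` is `f · gcd(r + us',
f)` and `sum_char_mul_gcd_linear` applies. If `f ∤ s`, the gcd depends on the unit `u` only modulo
`gcd(s, f)`, a proper divisor of `f`. -/
theorem twistValue_of_isCoprime {ψ : DirichletCharacter ℂ f} (hprim : ψ.IsPrimitive)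
    (hquad : ψ.IsQuadratic) {r s : ℤ} (hrs : IsCoprime r s) :
    twistValue ψ r s = nPsi ψ * (ψ r * charQuot ψ s) := by
  have hfC : (f : ℂ) ≠ 0 := by exact_mod_cast NeZero.ne f
  have hfZ : (f : ℤ) ≠ 0 := by exact_mod_cast NeZero.ne f
  by_cases hs : (f : ℤ) ∣ s
  · rw [charQuot, if_pos hs]
    obtain ⟨s', rfl⟩ := hs
    rw [Int.mul_ediv_cancel_left _ hfZ, nPsi_eq hprim hquad]
    have hgcd : ∀ u : ZMod f, (Int.gcd (f * r + u.val * (f * s')) (f * (f * s')) : ℂ) =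
        f * Int.gcd (r + u.val * s') f := fun u => by
      have h1 : (f * r + u.val * (f * s') : ℤ) = f * (r + u.val * s') := by ring
      have h2 : IsCoprime (r + u.val * s') s' :=
        IsCoprime.add_mul_right_left (hrs.of_mul_right_right) _
      rw [h1, Int.gcd_mul_left, Int.natAbs_natCast]
      rw [Int.gcd_mul_left_right_of_gcd_eq_one (Int.isCoprime_iff_gcd_eq_one.mp h2)]
      push_cast; rfl
    rw [twistValue]
    simp_rw [hgcd]
    have := sum_char_mul_gcd_linear hprim hquad (hrs.of_mul_right_left) s'
    have h3 : ∀ u : ZMod f, ψ u * (-(1 / 24) * ((f : ℂ) * Int.gcd (r + u.val * s') f) ^ 2 / (f * f)) =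
        -(1 / 24) * (ψ u * (Int.gcd (r + u.val * s') f : ℂ) ^ 2) := fun u => by
      field_simp
    simp_rw [h3, ← Finset.mul_sum]
    rw [this]
    ring
  · rw [charQuot, if_neg hs, mul_zero, mul_zero, twistValue]
    apply mul_eq_zero_of_right
    obtain ⟨f₁, hf₁⟩ : (Int.gcd s f : ℤ) ∣ f := Int.gcd_dvd_right ..
    obtain ⟨s₁, hs₁⟩ : (Int.gcd s f : ℤ) ∣ s := Int.gcd_dvd_left ..
    set h := Int.gcd s f with hh
    have hcop : IsCoprime s₁ f₁ := by
      have hne : (h : ℤ) ≠ 0 := fun e => hfZ (by rw [hf₁, e, zero_mul])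
      have := Int.gcd_eq_gcd_ab s f
      refine ⟨Int.gcdA s f, Int.gcdB s f, mul_left_cancel₀ hne ?_⟩
      rw [← hh] at this
      linear_combination -this - Int.gcdA s f * hs₁ - Int.gcdB s f * hf₁
    refine sum_char_mul_eq_zero_of_periodic hprim (d := h)
      (Int.natCast_dvd_natCast.mp (Int.gcd_dvd_right ..)) (fun e => hs ?_) _
      (fun x => -(1 / 24) * ((h * Int.gcd (f₁ * r + x * s₁) h : ℕ) : ℂ) ^ 2 / ((f : ℂ) * f))
      (fun x k => ?_) (fun u hu => ?_)
    · rw [← e]; exact Int.gcd_dvd_left ..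
    · have : f₁ * r + (x + h * k) * s₁ = (f₁ * r + x * s₁) + h * (k * s₁) := by ring
      rw [this]
      simp
    -- With `f = h f₁` and `s = h s₁`, the number `f₁r + us₁` is prime to `s₁` and, for `u` a unit,
    -- also to `f₁`. Hence only the factor `h` of `h f₁ s₁` contributes to the gcd.
    · congr 4
      have e1 : (f * r + u.val * s : ℤ) = h * (f₁ * r + u.val * s₁) := by
        linear_combination r * hf₁ + u.val * hs₁
      have e2 : (f * s : ℤ) = h * (h * f₁ * s₁) := by
        nth_rw 1 [hf₁]; nth_rw 1 [hs₁]; ring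
      rw [e1, e2, Int.gcd_mul_left, Int.natAbs_natCast]
      congr 1
      have c1 : IsCoprime (f₁ * r + u.val * s₁) s₁ := by
        refine IsCoprime.add_mul_right_left ?_ _
        refine hcop.symm.mul_left ?_
        rw [hs₁] at hrs
        exact hrs.of_mul_right_right
      have c2 : IsCoprime (f₁ * r + u.val * s₁) f₁ := by
        rw [add_comm]
        refine IsCoprime.add_mul_left_left (IsCoprime.mul_left ?_ hcop) _
        have hu' : IsUnit (((u.val : ℤ)) : ZMod f) := by
          push_cast; rwa [ZMod.natCast_zmod_val]
        have := ((ZMod.coe_int_isUnit_iff_isCoprime _ _).mp hu').symm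
        rw [hf₁] at this
        exact this.of_mul_right_right
      rw [Int.gcd_mul_left_right_of_gcd_eq_one (Int.isCoprime_iff_gcd_eq_one.mp c1),
        Int.gcd_mul_left_right_of_gcd_eq_one (Int.isCoprime_iff_gcd_eq_one.mp c2)]

end

end QuadraticEisenstein

end

noncomputable section

namespace QuadraticEisenstein

open UpperHalfPlane Filter Topology Matrix.SpecialLinearGroup
open scoped Manifold

/-! ### Euler factors -/

/-- The operator `1 - c γ_p`. -/
def eulerOp (c : ℕ → ℂ) (p : ℕ) (g : ℍ → ℂ) : ℍ → ℂ := g + (-c p) • gammaOp p g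

section

variable {f : ℕ}

theorem opPlus_eq (ψ : DirichletCharacter ℂ f) : opPlus ψ = eulerOp (fun p => 1 * ψ p) := by
  funext p g z
  simp [opPlus, eulerOp, sub_eq_add_neg]

theorem opMinus_eq {ψ : DirichletCharacter ℂ f} (hquad : ψ.IsQuadratic) :
    opMinus ψ = eulerOp (fun p => (p : ℂ)⁻¹ * ψ p) := by
  funext p g z
  simp [opMinus, eulerOp, sub_eq_add_neg, hquad.inv]

theorem isGamma0Invariant_foldr {N : ℕ} {g : ℍ → ℂ} (hg : IsGamma0Invariant N g) (c : ℕ → ℂ)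
    (l : List ℕ) (hl : ∀ p ∈ l, p.Prime) :
    IsGamma0Invariant (N * l.prod) (l.foldr (eulerOp c) g) := by
  induction l with
  | nil => simpa using hg
  | cons p l ih =>
    have ih' := ih fun q hq => hl q (List.mem_cons_of_mem p hq)
    have hp := hl p List.mem_cons_self
    rw [List.foldr_cons, List.prod_cons]
    refine IsGamma0Invariant.add (ih'.mono ?_) (((ih'.gammaOp hp.ne_zero).mono ?_).smul _)
    · exact mul_dvd_mul_left N (dvd_mul_left _ _)
    · exact dvd_of_eq (by ring)

theorem isHolomorphicUpTo_foldr {t : ℂ} {g : ℍ → ℂ} (hg : IsHolomorphicUpTo t g) (c : ℕ → ℂ)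
    (l : List ℕ) (hl : ∀ p ∈ l, p.Prime) :
    IsHolomorphicUpTo ((l.map fun p => 1 - c p).prod * t) (l.foldr (eulerOp c) g) := by
  induction l with
  | nil => simpa using hg
  | cons p l ih =>
    have ih' := ih fun q hq => hl q (List.mem_cons_of_mem p hq)
    have hp := hl p List.mem_cons_self
    rw [List.foldr_cons, List.map_cons, List.prod_cons]
    have h := ih'.add ((ih'.gammaOp hp.ne_zero).smul (-c p))
    convert h using 1
    · ring
    · rfl

/-- The effect of `1 - a ψ(p) γ_p` on the factor at `p` of the constant terms. -/
def eulerStep (a : ℂ) (p : ℕ) (W : ℕ∞ → ℂ) (v : ℕ∞) : ℂ :=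
  W v - a * (if v = 0 then W 0 / p else p * W (v - 1))

variable [NeZero f]

/-- The constant terms of `g` at the cusp `r / s` have an Euler product over the primes in `S`,
with factor `W p` depending on the valuation of `s` at `p`. -/
def HasEulerValues (ψ : DirichletCharacter ℂ f) (S : Finset ℕ) (g : ℍ → ℂ) (n : ℂ)
    (W : ℕ → ℕ∞ → ℂ) : Prop :=
  ∃ κ : ℤ → ℤ → ℂ, HasCuspValues g κ ∧ (∀ (k : ℕ) x y, κ (k * x) (k * y) = k ^ 2 * κ x y) ∧
    ∀ r s, IsCoprime r s →
      κ r s = n * (ψ r * charQuot ψ s) * ∏ q ∈ S, W q (emultiplicity (q : ℤ) s)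

theorem hasEulerValues_twistE2 {ψ : DirichletCharacter ℂ f} (hprim : ψ.IsPrimitive)
    (hquad : ψ.IsQuadratic) (S : Finset ℕ) :
    HasEulerValues ψ S (twistE2 ψ) (nPsi ψ) (fun _ _ => 1) := by
  refine ⟨twistValue ψ, hasCuspValues_twistE2 ψ, fun k x y => ?_, fun r s hrs => ?_⟩
  · rw [twistValue, twistValue, Finset.mul_sum, Finset.mul_sum, Finset.mul_sum]
    refine Finset.sum_congr rfl fun u _ => ?_
    have h1 : (f * (k * x) + u.val * (k * y) : ℤ) = k * (f * x + u.val * y) := by ring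
    have h2 : (f * (k * y) : ℤ) = k * (f * y) := by ring
    rw [h1, h2, Int.gcd_mul_left, Int.natAbs_natCast]
    push_cast
    ring
  · rw [twistValue_of_isCoprime hprim hquad hrs, Finset.prod_const_one, mul_one]

theorem charQuot_mul (ψ : DirichletCharacter ℂ f) {p : ℕ} (hp : Nat.Coprime p f) (s : ℤ) :
    charQuot ψ (p * s) = ψ p * charQuot ψ s := by
  have hf : (f : ℤ) ≠ 0 := by exact_mod_cast NeZero.ne f
  have hcop : IsCoprime (f : ℤ) p := (Nat.isCoprime_iff_coprime.mpr hp).symm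
  by_cases h : (f : ℤ) ∣ s
  · rw [charQuot, charQuot, if_pos h, if_pos (h.mul_left _)]
    obtain ⟨k, rfl⟩ := h
    rw [Int.mul_ediv_cancel_left _ hf, mul_left_comm, Int.mul_ediv_cancel_left _ hf]
    push_cast
    rw [map_mul]
  · rw [charQuot, charQuot, if_neg h, if_neg (fun h' => h (hcop.dvd_of_dvd_mul_left h')), mul_zero]

/-- The new value is `κ(r, s) - aψ(p) κ(pr, s)/p`. If `s = pt`, homogeneity gives `κ(pr, pt) = p²
κ(r, t)`, which lowers the valuation by one, and `ψ(p)` is absorbed by `charQuot_mul`. If `p ∤ s`,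
the pair `(pr, s)` is still coprime, and the second `ψ(p)` cancels the first. Valuations lie in `ℕ∞`
because `s = 0` occurs, at the cusp `∞`. -/
theorem HasEulerValues.eulerOp {ψ : DirichletCharacter ℂ f} (hquad : ψ.IsQuadratic)
    {S : Finset ℕ} (hS : ∀ q ∈ S, q.Prime ∧ Nat.Coprime q f) {g : ℍ → ℂ} {n : ℂ}
    {W : ℕ → ℕ∞ → ℂ} (hg : HasEulerValues ψ S g n W) (a : ℕ → ℂ) {p : ℕ} (hp : p ∈ S) :
    HasEulerValues ψ S (eulerOp (fun p => a p * ψ p) p g) n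
      (fun q => if q = p then eulerStep (a p) p (W p) else W q) := by
  obtain ⟨κ, h1, h2, h3⟩ := hg
  obtain ⟨hpp, hpf⟩ := hS p hp
  have hp0 : (p : ℂ) ≠ 0 := by exact_mod_cast hpp.ne_zero
  have hpZ : (p : ℤ) ≠ 0 := by exact_mod_cast hpp.ne_zero
  have hpZp : Prime (p : ℤ) := Nat.prime_iff_prime_int.mp hpp
  have hψ : ψ p * ψ p = 1 := by
    rw [← pow_two]
    exact sq_eq_one_of_isQuadratic hquad ((ZMod.isUnit_iff_coprime p f).mpr hpf)
  refine ⟨_, h1.add ((h1.gammaOp hpp.ne_zero).smul (-(a p * ψ p))), fun k x y => ?_,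
    fun r s hrs => ?_⟩
  · rw [h2, show (p : ℤ) * (k * x) = k * (p * x) by ring, h2]
    ring
  · beta_reduce
    have hprod : ∀ V : ℕ∞ → ℂ, ∏ q ∈ S, (if q = p then V else W q) (emultiplicity (q : ℤ) s) =
        V (emultiplicity (p : ℤ) s) * ∏ q ∈ S.erase p, W q (emultiplicity (q : ℤ) s) := fun V => by
      rw [← Finset.mul_prod_erase S _ hp, if_pos rfl]
      congr 1
      refine Finset.prod_congr rfl fun q hq => ?_
      rw [if_neg (Finset.ne_of_mem_erase hq)]
    rw [hprod, h3 r s hrs, ← Finset.mul_prod_erase S _ hp]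
    by_cases hs : (p : ℤ) ∣ s
    · obtain ⟨t, rfl⟩ := hs
      rw [h2, h3 r t hrs.of_mul_right_right, ← Finset.mul_prod_erase S _ hp, charQuot_mul ψ hpf]
      have he : emultiplicity (p : ℤ) (p * t) = emultiplicity (p : ℤ) t + 1 := by
        rw [emultiplicity_mul hpZp, add_comm,
          (Int.finiteMultiplicity_iff.mpr ⟨by simpa using hpp.ne_one, hpZ⟩).emultiplicity_self]
      have hq : ∀ q ∈ S.erase p, emultiplicity (q : ℤ) (p * t) = emultiplicity (q : ℤ) t :=
        fun q hq => by
          have hqp := (hS q (Finset.mem_of_mem_erase hq)).1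
          rw [emultiplicity_mul (Nat.prime_iff_prime_int.mp hqp), emultiplicity_eq_zero.mpr, zero_add]
          intro hd
          exact Finset.ne_of_mem_erase hq
            ((Nat.prime_dvd_prime_iff_eq hqp hpp).mp (Int.natCast_dvd_natCast.mp hd))
      rw [Finset.prod_congr rfl fun q h => by rw [hq q h], eulerStep, he, if_neg (by simp)]
      have hsub : emultiplicity (p : ℤ) t + 1 - 1 = emultiplicity (p : ℤ) t := by
        cases emultiplicity (p : ℤ) t using ENat.recTopCoe <;> rfl
      rw [hsub]
      field_simp
      linear_combination (0 : ℂ) * hψ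
    · rw [h3 (p * r) s ((((Prime.coprime_iff_not_dvd hpZp).mpr hs)).mul_left hrs),
        ← Finset.mul_prod_erase S _ hp, eulerStep, emultiplicity_eq_zero.mpr hs, if_pos rfl]
      push_cast
      rw [map_mul]
      linear_combination (-(a p) * n * ψ r * charQuot ψ s * W p 0 / p *
        ∏ q ∈ S.erase p, W q (emultiplicity (q : ℤ) s)) * hψ

theorem HasEulerValues.foldr {ψ : DirichletCharacter ℂ f} (hquad : ψ.IsQuadratic)
    {S : Finset ℕ} (hS : ∀ q ∈ S, q.Prime ∧ Nat.Coprime q f) {g : ℍ → ℂ} {n : ℂ}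
    {W : ℕ → ℕ∞ → ℂ} (hg : HasEulerValues ψ S g n W) (a : ℕ → ℂ) (l : List ℕ) (hl : l.Nodup)
    (hlS : ∀ p ∈ l, p ∈ S) :
    HasEulerValues ψ S (l.foldr (QuadraticEisenstein.eulerOp (fun p => a p * ψ p)) g) n
      (fun q => if q ∈ l then eulerStep (a q) q (W q) else W q) := by
  induction l with
  | nil => simpa using hg
  | cons p l ih =>
    rw [List.nodup_cons] at hl
    have h := (ih hl.2 fun q hq => hlS q (List.mem_cons_of_mem p hq)).eulerOp hquad hS a
      (hlS p List.mem_cons_self)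
    rw [if_neg hl.1] at h
    rw [List.foldr_cons]
    convert h using 2 with q
    by_cases hq : q = p
    · subst hq; simp
    · simp [hq]

end

/-! ### The modular form -/

section

variable {f M L : ℕ} [NeZero f] {ψ : DirichletCharacter ℂ f}

/-- The factor at `p` of the constant terms of `eis M L ψ`. -/
def localValue (f M L p : ℕ) : ℕ∞ → ℂ :=
  if p ∈ (L / f).primeFactorsList then
    eulerStep (p : ℂ)⁻¹ p
      (if p ∈ (M / f).primeFactorsList then eulerStep 1 p (fun _ => 1) else fun _ => 1)
  else if p ∈ (M / f).primeFactorsList then eulerStep 1 p (fun _ => 1) else fun _ => 1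

theorem eis_eq (hprim : ψ.IsPrimitive) (hquad : ψ.IsQuadratic) :
    eis M L ψ = (L / f).primeFactorsList.foldr (eulerOp (fun p => (p : ℂ)⁻¹ * ψ p))
      ((M / f).primeFactorsList.foldr (eulerOp (fun p => 1 * ψ p)) (twistE2 ψ)) := by
  rw [eis, opMinusProd, opPlusProd, eisPsi_eq_twistE2 hprim hquad, opPlus_eq, opMinus_eq hquad]

theorem hasEulerValues_eis (hprim : ψ.IsPrimitive) (hquad : ψ.IsQuadratic) {S : Finset ℕ}
    (hS : ∀ q ∈ S, q.Prime ∧ Nat.Coprime q f) (hM : Squarefree (M / f)) (hL : Squarefree (L / f))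
    (hMS : ∀ p ∈ (M / f).primeFactorsList, p ∈ S) (hLS : ∀ p ∈ (L / f).primeFactorsList, p ∈ S) :
    HasEulerValues ψ S (eis M L ψ) (nPsi ψ) (localValue f M L) := by
  rw [eis_eq hprim hquad]
  exact ((hasEulerValues_twistE2 hprim hquad S).foldr hquad hS (fun _ => 1) _
    ((Nat.squarefree_iff_nodup_primeFactorsList hM.ne_zero).mp hM) hMS).foldr hquad hS
    (fun p => (p : ℂ)⁻¹) _ ((Nat.squarefree_iff_nodup_primeFactorsList hL.ne_zero).mp hL) hLS

/-- The twist has level `f²` and each operator at `p` multiplies the level by `p`: in total `f² ·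
(M/f) · (L/f) = ML`. -/
theorem isGamma0Invariant_eis (hprim : ψ.IsPrimitive) (hquad : ψ.IsQuadratic) (hM0 : M ≠ 0)
    (hL0 : L ≠ 0) (hfM : f ∣ M) (hfL : f ∣ L) : IsGamma0Invariant (M * L) (eis M L ψ) := by
  rw [eis_eq hprim hquad]
  refine (isGamma0Invariant_foldr (isGamma0Invariant_foldr (isGamma0Invariant_twistE2 hquad) _ _
    fun p hp => Nat.prime_of_mem_primeFactorsList hp) _ _
    fun p hp => Nat.prime_of_mem_primeFactorsList hp).mono (dvd_of_eq ?_)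
  have h1 : M / f ≠ 0 := Nat.div_ne_zero_iff_of_dvd hfM |>.mpr ⟨hM0, NeZero.ne f⟩
  have h2 : L / f ≠ 0 := Nat.div_ne_zero_iff_of_dvd hfL |>.mpr ⟨hL0, NeZero.ne f⟩
  rw [Nat.prod_primeFactorsList h1, Nat.prod_primeFactorsList h2]
  obtain ⟨a, rfl⟩ := hfM
  obtain ⟨b, rfl⟩ := hfL
  have hf : 0 < f := Nat.pos_of_ne_zero (NeZero.ne f)
  rw [Nat.mul_div_cancel_left a hf, Nat.mul_div_cancel_left b hf]
  ring

/-- Since `γ_p` preserves `t / Im z`, the operator `1 - c γ_p` scales this term by `1 - c`. For `f ≠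
1` the term is already zero because `∑ ψ(u) = 0`. For `f = 1` a prime `p ∣ M` contributes the factor
`1 - 1`; this is where `M ≠ 1` enters. -/
theorem mdifferentiable_eis (hprim : ψ.IsPrimitive) (hquad : ψ.IsQuadratic) (hM0 : M ≠ 0)
    (hM1 : M ≠ 1) : MDiff (eis M L ψ) := by
  have h := isHolomorphicUpTo_foldr (isHolomorphicUpTo_foldr (isHolomorphicUpTo_twistE2 ψ)
    (fun p => 1 * ψ p) (M / f).primeFactorsList fun p hp => Nat.prime_of_mem_primeFactorsList hp)
    (fun p => (p : ℂ)⁻¹ * ψ p) (L / f).primeFactorsList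
    fun p hp => Nat.prime_of_mem_primeFactorsList hp
  rw [← eis_eq hprim hquad] at h
  have h0 : ((M / f).primeFactorsList.map fun p : ℕ => 1 - 1 * ψ (p : ZMod f)).prod *
      (1 / gaussG ψ * ∑ u : ZMod f, ψ u * (1 / (8 * Real.pi))) = 0 := by
    by_cases hf : f = 1
    · subst hf
      obtain ⟨p, hp, hpM⟩ := Nat.exists_prime_and_dvd hM1
      rw [List.prod_eq_zero, zero_mul]
      rw [List.mem_map]
      refine ⟨p, ?_, ?_⟩
      · rw [Nat.div_one]; exact (Nat.mem_primeFactorsList hM0).mpr ⟨hp, hpM⟩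
      · rw [DirichletCharacter.level_one ψ, MulChar.one_apply (isUnit_of_subsingleton _)]
        ring
    · rw [← Finset.sum_mul, sum_char_eq_zero hprim hf]
      ring
  rw [h0, mul_zero] at h
  simpa [IsHolomorphicUpTo] using h

theorem exists_modularForm_eq_eis {N : ℕ} [NeZero N] (hprim : ψ.IsPrimitive)
    (hquad : ψ.IsQuadratic) (hM0 : M ≠ 0) (hL0 : L ≠ 0) (hM1 : M ≠ 1) (hfM : f ∣ M) (hfL : f ∣ L)
    (hN : M * L ∣ N) {S : Finset ℕ} {n : ℂ} {W : ℕ → ℕ∞ → ℂ}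
    (hW : HasEulerValues ψ S (eis M L ψ) n W) :
    ∃ F : ModularForm (CongruenceSubgroup.Gamma0 N : Subgroup (GL (Fin 2) ℝ)) 2,
      (F : UpperHalfPlane → ℂ) = eis M L ψ := by
  have hinv := (isGamma0Invariant_eis hprim hquad hM0 hL0 hfM hfL).mono hN
  obtain ⟨κ, hκ, -⟩ := hW
  refine ⟨{ toFun := eis M L ψ
            slash_action_eq' := ?_
            holo' := mdifferentiable_eis hprim hquad hM0 hM1
            bdd_at_cusps' := ?_ }, rfl⟩
  · rintro _ ⟨γ, hγ, rfl⟩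
    exact hinv γ hγ
  · intro c hc
    rw [Subgroup.IsArithmetic.isCusp_iff_isCusp_SL2Z] at hc
    rw [OnePoint.isBoundedAt_iff_forall_SL2Z hc]
    intro γ _
    exact (hκ.tendsto_slash γ).isBigO_one ℝ

end

end QuadraticEisenstein

end

noncomputable section

namespace QuadraticEisenstein

open Matrix.SpecialLinearGroup

/-! ### Widths of cusps -/

theorem coe_conj_T_pow (γ : SL(2, ℤ)) (h : ℕ) :
    ((γ * ModularGroup.T ^ h * γ⁻¹ : SL(2, ℤ)) : Matrix (Fin 2) (Fin 2) ℤ) =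
      !![1 - h * (γ 0 0 * γ 1 0), h * γ 0 0 ^ 2; -(h * γ 1 0 ^ 2), 1 + h * (γ 0 0 * γ 1 0)] := by
  have hdet := γ.det_coe
  rw [Matrix.det_fin_two] at hdet
  have hT : ((ModularGroup.T ^ h : SL(2, ℤ)) : Matrix (Fin 2) (Fin 2) ℤ) = !![1, (h : ℤ); 0, 1] := by
    rw [← zpow_natCast, ModularGroup.coe_T_zpow]
  rw [coe_mul, coe_mul, hT, coe_inv, Matrix.adjugate_fin_two]
  ext i j
  fin_cases i <;> fin_cases j <;> simp [Matrix.mul_apply, Fin.sum_univ_two]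
  · linear_combination hdet
  · ring
  · ring
  · linear_combination hdet

theorem sInf_dvd_mul (N : ℕ) (hN : N ≠ 0) (t : ℕ) :
    sInf {h : ℕ | 0 < h ∧ N ∣ h * t} = N / Nat.gcd t N := by
  have hg : 0 < Nat.gcd t N := Nat.gcd_pos_of_pos_right _ (Nat.pos_of_ne_zero hN)
  obtain ⟨n, hn⟩ := Nat.gcd_dvd_right t N
  obtain ⟨t', ht'⟩ := Nat.gcd_dvd_left t N
  set g := Nat.gcd t N with hgdef
  have hcop : Nat.Coprime n t' := by
    have : g * Nat.gcd t' n = g * 1 := by rw [← Nat.gcd_mul_left, ← ht', ← hn, mul_one]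
    exact (Nat.coprime_comm.mp (Nat.eq_of_mul_eq_mul_left hg this))
  have hn0 : 0 < n := Nat.pos_of_ne_zero fun h => hN (by rw [hn, h, mul_zero])
  have hset : {h : ℕ | 0 < h ∧ N ∣ h * t} = {h : ℕ | 0 < h ∧ n ∣ h} := by
    ext h
    simp only [Set.mem_ofPred_eq, and_congr_right_iff]
    intro _
    rw [hn, ht', mul_left_comm, Nat.mul_dvd_mul_iff_left hg]
    exact ⟨fun hd => hcop.dvd_of_dvd_mul_right hd, fun hd => hd.mul_right _⟩
  rw [hset, show N / g = n by rw [hn]; exact Nat.mul_div_cancel_left n hg]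
  refine le_antisymm (Nat.sInf_le ⟨hn0, dvd_rfl⟩) ?_
  refine le_csInf ⟨n, hn0, dvd_rfl⟩ fun h hh => Nat.le_of_dvd hh.1 hh.2

theorem ramIndex_Gamma0 (N : ℕ) (hN : N ≠ 0) (γ : SL(2, ℤ)) :
    ramIndex (CongruenceSubgroup.Gamma0 N) γ = N / Nat.gcd ((γ 1 0).natAbs ^ 2) N := by
  rw [ramIndex, ← sInf_dvd_mul N hN]
  congr 1
  ext h
  have hdvd : (N : ℤ) ∣ h * γ 1 0 ^ 2 ↔ N ∣ h * (γ 1 0).natAbs ^ 2 := by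
    rw [← Int.natAbs_dvd_natAbs]
    simp [Int.natAbs_mul, Int.natAbs_pow]
  simp only [Set.mem_ofPred_eq, CongruenceSubgroup.Gamma0_mem, coe_neg, coe_conj_T_pow,
    Matrix.neg_apply, ZMod.intCast_zmod_eq_zero_iff_dvd]
  simp [hdvd]

/-- With first column `(a, c)`, membership of `γ T^h γ⁻¹` means `N ∣ hac` and `N ∣ hc²`, that is `N
∣ hc` since `a` and `c` are coprime. Membership of the negative compares traces, `-2 ≡ 2` modulo
`N`, so `N ∣ 4`; for `N ≤ 2` signs are invisible modulo `N`, which leaves only `N = 4` exceptional.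
-/
theorem ramIndex_Gamma1 (N : ℕ) (hN : N ≠ 0) (hN4 : N ≠ 4) (γ : SL(2, ℤ)) :
    ramIndex (CongruenceSubgroup.Gamma1 N) γ = N / Nat.gcd (γ 1 0).natAbs N := by
  rw [ramIndex, ← sInf_dvd_mul N hN]
  congr 1
  ext h
  have hcop : IsCoprime (γ 0 0) (γ 1 0) := by
    have hdet := γ.det_coe
    rw [Matrix.det_fin_two] at hdet
    exact ⟨γ 1 1, -γ 0 1, by linear_combination hdet⟩
  have hdvd : (N : ℤ) ∣ h * γ 1 0 ↔ N ∣ h * (γ 1 0).natAbs := by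
    rw [← Int.natAbs_dvd_natAbs]
    simp [Int.natAbs_mul]
  have hboth : ((N : ℤ) ∣ h * (γ 0 0 * γ 1 0) ∧ (N : ℤ) ∣ h * γ 1 0 ^ 2) ↔
      (N : ℤ) ∣ h * γ 1 0 := by
    constructor
    · rintro ⟨h1, h2⟩
      obtain ⟨u, v, huv⟩ := hcop
      have : (h : ℤ) * γ 1 0 = u * (h * (γ 0 0 * γ 1 0)) + v * (h * γ 1 0 ^ 2) := by
        linear_combination (-(h * γ 1 0 : ℤ)) * huv
      rw [this]
      exact dvd_add (h1.mul_left u) (h2.mul_left v)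
    · intro hd
      exact ⟨by rw [mul_left_comm]; exact hd.mul_left _, by rw [pow_two, ← mul_assoc]; exact hd.mul_right _⟩
  simp only [Set.mem_ofPred_eq, CongruenceSubgroup.Gamma1_mem, coe_neg, coe_conj_T_pow,
    Matrix.neg_apply, ← hdvd, ← hboth]
  simp only [Matrix.of_apply, Matrix.cons_val', Matrix.cons_val_zero, Matrix.cons_val_one,
    Matrix.cons_val_fin_one, neg_neg]
  have hplus : (((1 - h * (γ 0 0 * γ 1 0) : ℤ) : ZMod N) = 1 ∧
      ((1 + h * (γ 0 0 * γ 1 0) : ℤ) : ZMod N) = 1 ∧ ((-(h * γ 1 0 ^ 2) : ℤ) : ZMod N) = 0) ↔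
      ((N : ℤ) ∣ h * (γ 0 0 * γ 1 0) ∧ (N : ℤ) ∣ h * γ 1 0 ^ 2) := by
    rw [← ZMod.intCast_zmod_eq_zero_iff_dvd, ← ZMod.intCast_zmod_eq_zero_iff_dvd]
    push_cast
    simp
  rw [hplus]
  refine and_congr_right fun _ => or_iff_left_of_imp ?_
  rintro ⟨h1, h2, h3⟩
  have hN4' : N ∣ 4 := by
    rw [← ZMod.natCast_eq_zero_iff]
    push_cast at h1 h2 ⊢
    linear_combination -h1 - h2
  have hN2 : (2 : ZMod N) = 0 := by
    have : N ≤ 4 := Nat.le_of_dvd (by norm_num) hN4'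
    have h2' : N ∣ 2 := by
      interval_cases N
      · exact absurd rfl hN
      · norm_num
      · norm_num
      · norm_num at hN4'
      · exact absurd rfl hN4
    exact_mod_cast (ZMod.natCast_eq_zero_iff 2 N).mpr h2'
  rw [← ZMod.intCast_zmod_eq_zero_iff_dvd, ← ZMod.intCast_zmod_eq_zero_iff_dvd]
  push_cast at h1 h3 ⊢
  exact ⟨by linear_combination h1 + hN2, h3⟩

/-- The units modulo 4 are `±1`, so `±Γ₁(4) = Γ₀(4)`. -/
theorem ramIndex_Gamma1_four (γ : SL(2, ℤ)) :
    ramIndex (CongruenceSubgroup.Gamma1 4) γ = ramIndex (CongruenceSubgroup.Gamma0 4) γ := by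
  have hmem : ∀ A : SL(2, ℤ), (A ∈ CongruenceSubgroup.Gamma1 4 ∨ -A ∈ CongruenceSubgroup.Gamma1 4) ↔
      (A ∈ CongruenceSubgroup.Gamma0 4 ∨ -A ∈ CongruenceSubgroup.Gamma0 4) := fun A => by
    have hdet := congrArg (Int.cast : ℤ → ZMod 4) A.det_coe
    rw [Matrix.det_fin_two] at hdet
    push_cast at hdet
    simp only [CongruenceSubgroup.Gamma1_mem, CongruenceSubgroup.Gamma0_mem, coe_neg,
      Matrix.neg_apply, Int.cast_neg]
    generalize ((A 0 0 : ℤ) : ZMod 4) = a at *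
    generalize ((A 0 1 : ℤ) : ZMod 4) = b at *
    generalize ((A 1 0 : ℤ) : ZMod 4) = c at *
    generalize ((A 1 1 : ℤ) : ZMod 4) = d at *
    constructor
    · rintro (⟨-, -, h⟩ | ⟨-, -, h⟩)
      · exact Or.inl h
      · exact Or.inr h
    · intro h
      have hc : c = 0 := h.elim id neg_eq_zero.mp
      subst hc
      have key : ∀ a d : ZMod 4, a * d = 1 → (a = 1 ∧ d = 1) ∨ (-a = 1 ∧ -d = 1) := by decide
      rw [mul_zero, sub_zero] at hdet
      rcases key a d hdet with ⟨h1, h2⟩ | ⟨h1, h2⟩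
      · exact Or.inl ⟨h1, h2, rfl⟩
      · exact Or.inr ⟨h1, h2, neg_zero⟩
  rw [ramIndex, ramIndex]
  simp_rw [hmem]

theorem prod_div_gcd (S : Finset ℕ) (hS : ∀ p ∈ S, p.Prime) (e : ℕ → ℕ) (t : ℕ) :
    (∏ p ∈ S, p ^ e p) / Nat.gcd t (∏ p ∈ S, p ^ e p) = ∏ p ∈ S, p ^ e p / Nat.gcd t (p ^ e p) := by
  have hgcd : Nat.gcd t (∏ p ∈ S, p ^ e p) = ∏ p ∈ S, Nat.gcd t (p ^ e p) := by
    induction S using Finset.induction_on with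
    | empty => simp
    | insert p S hp ih =>
      have hcop : Nat.Coprime (p ^ e p) (∏ q ∈ S, q ^ e q) :=
        Nat.Coprime.prod_right fun q hq => ((Nat.coprime_primes (hS p (Finset.mem_insert_self p S))
          (hS q (Finset.mem_insert_of_mem hq))).mpr fun h => hp (h ▸ hq)).pow _ _
      rw [Finset.prod_insert hp, Finset.prod_insert hp, Nat.Coprime.gcd_mul _ hcop,
        ih fun q hq => hS q (Finset.mem_insert_of_mem hq)]
  have hpos : ∀ p ∈ S, 0 < Nat.gcd t (p ^ e p) := fun p hp =>
    Nat.gcd_pos_of_pos_right _ (pow_pos (hS p hp).pos _)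
  rw [hgcd]
  refine Nat.div_eq_of_eq_mul_left (Finset.prod_pos hpos) ?_
  rw [← Finset.prod_mul_distrib]
  exact Finset.prod_congr rfl fun p _ => (Nat.div_mul_cancel (Nat.gcd_dvd_right _ _)).symm

end QuadraticEisenstein

end

noncomputable section

namespace QuadraticEisenstein

/-! ### Local factors of the residues -/

theorem localValue_eq {f M L p : ℕ} [NeZero f] (hp : p.Prime) (hpf : Nat.Coprime p f)
    (hM0 : M ≠ 0) (hL0 : L ≠ 0) (hfM : f ∣ M) (hfL : f ∣ L) :
    localValue f M L p = if p ∣ L then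
      eulerStep (p : ℂ)⁻¹ p (if p ∣ M then eulerStep 1 p (fun _ => 1) else fun _ => 1)
      else if p ∣ M then eulerStep 1 p (fun _ => 1) else fun _ => 1 := by
  have key : ∀ K : ℕ, K ≠ 0 → f ∣ K → (p ∈ (K / f).primeFactorsList ↔ p ∣ K) := fun K hK hfK => by
    obtain ⟨k, rfl⟩ := hfK
    have hf : 0 < f := Nat.pos_of_ne_zero (NeZero.ne f)
    rw [Nat.mul_div_cancel_left k hf, Nat.mem_primeFactorsList (right_ne_zero_of_mul hK)]
    exact ⟨fun h => h.2.mul_left f, fun h => ⟨hp, hpf.dvd_of_dvd_mul_left h⟩⟩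
  unfold localValue
  simp only [key M hM0 hfM, key L hL0 hfL]

/-- The local generator of the residues at `p`. -/
def localGen (M L C p : ℕ) : ℂ :=
  ((p : ℂ) - 1) * (if p ∣ L then ((p : ℂ) + 1) / p else 1) *
    (if p ∣ C ∧ ¬ p ∣ M then (p : ℂ) else 1)

/-- The multiple of `localGen` occurring at the cusp `r / s`, for `Γ₀`. -/
def localMult0 (M L C p : ℕ) (s : ℤ) : ℤ :=
  if p ∣ M then
    if p ∣ L then if (p : ℤ) ∣ s then if (p : ℤ) ^ 2 ∣ s then 0 else -1 else p - 1
    else if (p : ℤ) ∣ s then -1 else if p ∣ C then p else 1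
  else if (p : ℤ) ∣ s then 0 else 1

/-- The multiple of `localGen` occurring at the cusp `r / s`, for `Γ₁`. -/
def localMult1 (M L C p : ℕ) (s : ℤ) : ℤ :=
  if p ∣ M then
    if p ∣ L then if (p : ℤ) ∣ s then if (p : ℤ) ^ 2 ∣ s then 0 else -p else p - 1
    else if (p : ℤ) ∣ s then if p ∣ C ∧ ¬ (p : ℤ) ^ 2 ∣ s then -p else -1
      else if p ∣ C then p else 1
  else if (p : ℤ) ∣ s then 0 else 1

/-- The local exponent of the level `DC`. -/
def levelExp (C p : ℕ) : ℕ := if p ∣ C then 2 else 1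

theorem gcd_prime_pow_of_not_dvd {p t : ℕ} (hp : p.Prime) (h : ¬ p ∣ t) (k : ℕ) :
    Nat.gcd t (p ^ k) = 1 :=
  (((Nat.Prime.coprime_iff_not_dvd hp).mpr h).symm.pow_right k)

theorem gcd_prime_sq_of_dvd {p t : ℕ} (hp : p.Prime) (h : p ∣ t) (h2 : ¬ p ^ 2 ∣ t) :
    Nat.gcd t (p ^ 2) = p := by
  obtain ⟨u, rfl⟩ := h
  have hu : ¬ p ∣ u := fun h => h2 (by rw [pow_two]; exact mul_dvd_mul_left p h)
  rw [pow_two, Nat.gcd_mul_left]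
  have := gcd_prime_pow_of_not_dvd hp hu 1
  rw [pow_one] at this
  rw [this, mul_one]

/-- Let `v` be the valuation of `s` at `p`. The Euler factor is `1 - 1/p` (`v = 0`), `1 - p` (`v ≥
1`) if `p` divides only `M`; `1 - 1/p²` (`v = 0`), `0` (`v ≥ 1`) if `p` divides only `L`; `(1 -
1/p)(1 - 1/p²)` (`v = 0`), `-(p² - 1)/p` (`v = 1`), `0` (`v ≥ 2`) if `p` divides both. With `e =
levelExp C p`, the local width at `v = 0` is `p^e` for both groups. For `v ≥ 1` it is `1` for `Γ₀`;
for `Γ₁` it is `p^(e-1)` at `v = 1` and `1` beyond. -/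
theorem local_factor {M L C p : ℕ} (hp : p.Prime) (hML : p ∣ M ∨ p ∣ L)
    (hC : p ∣ M → p ∣ L → p ∣ C) (s : ℤ) :
    ((p ^ levelExp C p / Nat.gcd (s.natAbs ^ 2) (p ^ levelExp C p) : ℕ) : ℂ) * (if p ∣ L then
      eulerStep (p : ℂ)⁻¹ p (if p ∣ M then eulerStep 1 p (fun _ => 1) else fun _ => 1)
      else if p ∣ M then eulerStep 1 p (fun _ => 1) else fun _ => 1) (emultiplicity (p : ℤ) s) =
      localMult0 M L C p s * localGen M L C p ∧
    ((p ^ levelExp C p / Nat.gcd s.natAbs (p ^ levelExp C p) : ℕ) : ℂ) * (if p ∣ L then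
      eulerStep (p : ℂ)⁻¹ p (if p ∣ M then eulerStep 1 p (fun _ => 1) else fun _ => 1)
      else if p ∣ M then eulerStep 1 p (fun _ => 1) else fun _ => 1) (emultiplicity (p : ℤ) s) =
      localMult1 M L C p s * localGen M L C p := by
  have hp0 : (p : ℂ) ≠ 0 := by exact_mod_cast hp.ne_zero
  have hnat : ∀ k : ℕ, (p : ℤ) ^ k ∣ s ↔ p ^ k ∣ s.natAbs := fun k => by
    rw [← Int.natCast_dvd]; push_cast; rfl
  have hnat1 : (p : ℤ) ∣ s ↔ p ∣ s.natAbs := by simpa using hnat 1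
  by_cases hs : (p : ℤ) ∣ s
  · have hs' := hnat1.mp hs
    have hv0 : emultiplicity (p : ℤ) s ≠ 0 := fun h => emultiplicity_eq_zero.mp h hs
    have hsq : p ^ 2 ∣ s.natAbs ^ 2 := pow_dvd_pow_of_dvd hs' 2
    by_cases hs2 : (p : ℤ) ^ 2 ∣ s
    · have hv1 : emultiplicity (p : ℤ) s - 1 ≠ 0 := fun h => by
        have h2 : ((2 : ℕ) : ℕ∞) ≤ emultiplicity (p : ℤ) s := le_emultiplicity_of_pow_dvd hs2
        have h1 : emultiplicity (p : ℤ) s ≤ 1 := tsub_eq_zero_iff_le.mp h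
        exact absurd (h2.trans h1) (by norm_num)
      have e2 : ∀ k, k = 1 ∨ k = 2 → p ^ k / Nat.gcd (s.natAbs ^ 2) (p ^ k) = 1 := by
        rintro k (rfl | rfl)
        · rw [Nat.gcd_eq_right (by rw [pow_one]; exact hs'.trans (dvd_pow_self _ two_ne_zero)),
            Nat.div_self (pow_pos hp.pos _)]
        · rw [Nat.gcd_eq_right hsq, Nat.div_self (pow_pos hp.pos _)]
      have e1 : ∀ k, k = 1 ∨ k = 2 → p ^ k / Nat.gcd s.natAbs (p ^ k) = 1 := by
        rintro k (rfl | rfl)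
        · rw [Nat.gcd_eq_right (by rw [pow_one]; exact hs'), Nat.div_self (pow_pos hp.pos _)]
        · rw [Nat.gcd_eq_right ((hnat 2).mp hs2), Nat.div_self (pow_pos hp.pos _)]
      have hk : levelExp C p = 1 ∨ levelExp C p = 2 := by unfold levelExp; split_ifs <;> simp
      rw [e1 _ hk, e2 _ hk]
      by_cases hM : p ∣ M
      · by_cases hL : p ∣ L
        · simp [hM, hL, hs, hs2, eulerStep, hv0, hv1, localMult0, localMult1, hp0]
        · simp [hM, hL, hs, hs2, eulerStep, hv0, localMult0, localMult1, localGen]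
      · have hL : p ∣ L := hML.resolve_left hM
        simp [hM, hL, hs, eulerStep, hv0, localMult0, localMult1, hp0]
    · have hv1 : emultiplicity (p : ℤ) s = 1 := by
        have : emultiplicity (p : ℤ) s = ((1 : ℕ) : ℕ∞) :=
          emultiplicity_eq_coe.mpr ⟨by rwa [pow_one], hs2⟩
        simpa using this
      have g2 : p ^ 2 / Nat.gcd (s.natAbs ^ 2) (p ^ 2) = 1 := by
        rw [Nat.gcd_eq_right hsq, Nat.div_self (pow_pos hp.pos _)]
      have g1 : p ^ 2 / Nat.gcd s.natAbs (p ^ 2) = p := by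
        rw [gcd_prime_sq_of_dvd hp hs' (fun h => hs2 ((hnat 2).mpr h)), pow_two,
          Nat.mul_div_cancel _ hp.pos]
      have g2' : p / Nat.gcd (s.natAbs ^ 2) p = 1 := by
        rw [Nat.gcd_eq_right (hs'.trans (dvd_pow_self _ two_ne_zero)), Nat.div_self hp.pos]
      have g1' : p / Nat.gcd s.natAbs p = 1 := by
        rw [Nat.gcd_eq_right hs', Nat.div_self hp.pos]
      by_cases hM : p ∣ M
      · by_cases hL : p ∣ L
        · simp [hM, hL, hs, hs2, eulerStep, hv1, localMult0, localMult1, levelExp, hC hM hL, g1, g2,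
            localGen]
          constructor <;> field_simp <;> ring
        · by_cases hc : p ∣ C
          · simp [hM, hL, hs, hs2, eulerStep, hv1, localMult0, localMult1, levelExp, hc, g1, g2,
              localGen]
            ring
          · simp [hM, hL, hs, eulerStep, hv1, localMult0, localMult1, levelExp, hc, g1', g2',
              localGen]
      · have hL : p ∣ L := hML.resolve_left hM
        simp [hM, hL, hs, eulerStep, hv1, localMult0, localMult1, hp0]
  · have hs' : ¬ p ∣ s.natAbs := fun h => hs (hnat1.mpr h)
    have hv0 : emultiplicity (p : ℤ) s = 0 := emultiplicity_eq_zero.mpr hs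
    have g1 := gcd_prime_pow_of_not_dvd hp hs' (levelExp C p)
    have g2 := gcd_prime_pow_of_not_dvd hp (fun h => hs' (hp.dvd_of_dvd_pow h) : ¬ p ∣ s.natAbs ^ 2)
      (levelExp C p)
    rw [g1, g2, Nat.div_one, hv0]
    by_cases hM : p ∣ M
    · by_cases hL : p ∣ L
      · simp [hM, hL, hs, eulerStep, localMult0, localMult1, levelExp, hC hM hL, localGen]
        field_simp
        ring
      · by_cases hc : p ∣ C
        · simp [hM, hL, hs, eulerStep, localMult0, localMult1, levelExp, hc, localGen]
          field_simp
        · simp [hM, hL, hs, eulerStep, localMult0, localMult1, levelExp, hc, localGen]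
          field_simp
    · have hL : p ∣ L := hML.resolve_left hM
      by_cases hc : p ∣ C
      · simp [hM, hL, hs, eulerStep, localMult0, localMult1, levelExp, hc, localGen]
        field_simp
        ring
      · simp [hM, hL, hs, eulerStep, localMult0, localMult1, levelExp, hc, localGen]
        field_simp
        ring

end QuadraticEisenstein

end

noncomputable section

namespace QuadraticEisenstein

/-! ### Values of the character at the cusps -/

theorem exists_eq_mul_of_charQuot_ne_zero {f : ℕ} [NeZero f] {ψ : DirichletCharacter ℂ f} {s : ℤ}
    (h : charQuot ψ s ≠ 0) :
    ∃ t : ℤ, s = f * t ∧ IsCoprime t (f : ℤ) := by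
  unfold charQuot at h
  split_ifs at h with hs
  · obtain ⟨t, rfl⟩ := hs
    have hf : (f : ℤ) ≠ 0 := by exact_mod_cast NeZero.ne f
    rw [Int.mul_ediv_cancel_left _ hf] at h
    refine ⟨t, rfl, ?_⟩
    have hu : IsUnit ((t : ℤ) : ZMod f) := by
      by_contra hu
      exact h (ψ.map_nonunit hu)
    exact (ZMod.coe_int_isUnit_iff_isCoprime t f).mp hu |>.symm
  · exact absurd rfl h

theorem exists_int_eq_char_mul_charQuot {f : ℕ} {ψ : DirichletCharacter ℂ f} (hquad : ψ.IsQuadratic)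
    (r s : ℤ) :
    ∃ k : ℤ, ψ r * charQuot ψ s = k := by
  have hψ : ∀ a : ZMod f, ∃ k : ℤ, ψ a = k := fun a => by
    rcases hquad a with h | h | h
    · exact ⟨0, by simp [h]⟩
    · exact ⟨1, by simp [h]⟩
    · exact ⟨-1, by simp [h]⟩
  obtain ⟨k, hk⟩ := hψ r
  unfold charQuot
  split_ifs
  · obtain ⟨l, hl⟩ := hψ ((s / f : ℤ) : ZMod f)
    exact ⟨k * l, by rw [hk, hl]; push_cast; rfl⟩
  · exact ⟨0, by simp⟩

/-- The cusps `1 / s` with `s = f t`, `t` prime to `f`. -/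
theorem exists_cusp_char_mul_charQuot {f : ℕ} [NeZero f] {ψ : DirichletCharacter ℂ f}
    (hquad : ψ.IsQuadratic)
    {t : ℕ} (ht : Nat.Coprime t f) : ∃ γ : SL(2, ℤ), γ 1 0 = (f : ℤ) * t ∧
      (ψ (γ 0 0) * charQuot ψ (γ 1 0) = 1 ∨ ψ (γ 0 0) * charQuot ψ (γ 1 0) = -1) := by
  have hf : (f : ℤ) ≠ 0 := by exact_mod_cast NeZero.ne f
  refine ⟨⟨!![1, 0; f * t, 1], by simp [Matrix.det_fin_two]⟩, by simp, ?_⟩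
  have h1 : (ψ (((1 : ℤ) : ZMod f)) * charQuot ψ ((f : ℤ) * t)) = ψ (t : ZMod f) := by
    rw [charQuot, if_pos (dvd_mul_right _ _), Int.mul_ediv_cancel_left _ hf]
    simp
  have h2 : IsUnit (t : ZMod f) := (ZMod.isUnit_iff_coprime t f).mpr ht
  have h3 := sq_eq_one_of_isQuadratic hquad h2
  simp only [Matrix.of_apply, Matrix.cons_val', Matrix.cons_val_zero,
    Matrix.cons_val_one, Matrix.cons_val_fin_one]
  rw [h1]
  exact mul_self_eq_one_iff.mp (by rw [← pow_two, h3])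

theorem dvd_mul_prod_iff {f : ℕ} {S : Finset ℕ}
    (hS : ∀ q ∈ S, q.Prime ∧ Nat.Coprime q f)
    (e : ℕ → ℕ) {p : ℕ} (hp : p ∈ S) (k : ℕ) :
    (p : ℤ) ^ k ∣ (f : ℤ) * ((∏ q ∈ S, q ^ e q : ℕ) : ℤ) ↔ k ≤ e p := by
  have h0 : (p : ℤ) ^ k ∣ (f : ℤ) * ((∏ q ∈ S, q ^ e q : ℕ) : ℤ) ↔ p ^ k ∣ f * ∏ q ∈ S, q ^ e q := by
    exact_mod_cast Iff.rfl
  have hpp := (hS p hp).1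
  rw [h0, ((hS p hp).2.pow_left k).dvd_mul_left, ← Finset.mul_prod_erase S _ hp]
  have hc : Nat.Coprime (p ^ k) (∏ q ∈ S.erase p, q ^ e q) :=
    Nat.Coprime.prod_right fun q hq => Nat.coprime_pow_primes _ _ hpp
      (hS q (Finset.mem_of_mem_erase hq)).1 (Finset.ne_of_mem_erase hq).symm
  rw [hc.dvd_mul_right]
  exact Nat.pow_dvd_pow_iff_le_right hpp.one_lt

/-! ### The arithmetic of admissible levels -/

/-- The divisibility conditions on the levels of the Eisenstein series. -/
structure IsAdmissible (D C M L f : ℕ) : Prop where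
  squarefree : Squarefree D
  C_dvd : C ∣ D
  M_dvd : M ∣ D
  L_dvd : L ∣ D
  dvd_mul : D ∣ M * L
  mul_dvd : M * L ∣ D * C
  f_dvd_M : f ∣ M
  f_dvd_L : f ∣ L

namespace IsAdmissible

variable {D C M L f p : ℕ}

theorem D_ne_zero (h : IsAdmissible D C M L f) : D ≠ 0 := h.squarefree.ne_zero

theorem M_ne_zero (h : IsAdmissible D C M L f) : M ≠ 0 := ne_zero_of_dvd_ne_zero h.D_ne_zero h.M_dvd

theorem L_ne_zero (h : IsAdmissible D C M L f) : L ≠ 0 := ne_zero_of_dvd_ne_zero h.D_ne_zero h.L_dvd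

theorem C_ne_zero (h : IsAdmissible D C M L f) : C ≠ 0 := ne_zero_of_dvd_ne_zero h.D_ne_zero h.C_dvd

theorem f_dvd_D (h : IsAdmissible D C M L f) : f ∣ D := h.f_dvd_M.trans h.M_dvd

theorem f_ne_zero (h : IsAdmissible D C M L f) : f ≠ 0 :=
  ne_zero_of_dvd_ne_zero h.D_ne_zero h.f_dvd_D

theorem level_ne_zero (h : IsAdmissible D C M L f) : D * C ≠ 0 := mul_ne_zero h.D_ne_zero h.C_ne_zero

theorem coprime_div (h : IsAdmissible D C M L f) : Nat.Coprime f (D / f) :=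
  Nat.coprime_of_squarefree_mul (by rw [Nat.mul_div_cancel' h.f_dvd_D]; exact h.squarefree)

theorem squarefree_div (h : IsAdmissible D C M L f) : Squarefree (D / f) :=
  h.squarefree.squarefree_of_dvd (Nat.div_dvd_of_dvd h.f_dvd_D)

theorem primeFactors_eq (h : IsAdmissible D C M L f) :
    D.primeFactors = f.primeFactors ∪ (D / f).primeFactors := by
  rw [← h.coprime_div.primeFactors_mul, Nat.mul_div_cancel' h.f_dvd_D]

theorem disjoint (h : IsAdmissible D C M L f) : Disjoint f.primeFactors (D / f).primeFactors :=
  h.coprime_div.disjoint_primeFactors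

theorem mem_iff (h : IsAdmissible D C M L f) :
    p ∈ (D / f).primeFactors ↔ p.Prime ∧ p ∣ D ∧ ¬ p ∣ f := by
  have h1 : p ∈ D.primeFactors ↔ p ∈ f.primeFactors ∨ p ∈ (D / f).primeFactors := by
    rw [h.primeFactors_eq, Finset.mem_union]
  have h2 : p ∈ f.primeFactors → p ∉ (D / f).primeFactors := fun a b =>
    Finset.disjoint_left.mp h.disjoint a b
  have h3 : p ∈ D.primeFactors ↔ p.Prime ∧ p ∣ D := by simp [Nat.mem_primeFactors, h.D_ne_zero]
  have h4 : p ∈ f.primeFactors ↔ p.Prime ∧ p ∣ f := by simp [Nat.mem_primeFactors, h.f_ne_zero]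
  tauto

theorem coprime_of_mem (h : IsAdmissible D C M L f) (hp : p ∈ (D / f).primeFactors) :
    Nat.Coprime p f :=
  (Nat.Prime.coprime_iff_not_dvd (h.mem_iff.mp hp).1).mpr (h.mem_iff.mp hp).2.2

theorem dvd_M_or_dvd_L (h : IsAdmissible D C M L f) (hp : p.Prime) (hpD : p ∣ D) :
    p ∣ M ∨ p ∣ L :=
  (Nat.Prime.dvd_mul hp).mp (hpD.trans h.dvd_mul)

/-- Here `p² ∣ ML ∣ DC`, whereas `p²` does not divide the square-free `D`. -/
theorem dvd_C (h : IsAdmissible D C M L f) (hp : p.Prime) (hM : p ∣ M) (hL : p ∣ L) : p ∣ C := by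
  by_contra hC
  have h1 : p * p ∣ D * C := (mul_dvd_mul hM hL).trans h.mul_dvd
  have h2 : Nat.Coprime (p * p) C := by
    have := (Nat.Prime.coprime_iff_not_dvd hp).mpr hC
    exact Nat.Coprime.mul_left this this
  exact hp.one_lt.ne' (Nat.isUnit_iff.mp (h.squarefree p (h2.dvd_of_dvd_mul_right h1)))

theorem prod_levelExp (h : IsAdmissible D C M L f) :
    ∏ p ∈ D.primeFactors, p ^ levelExp C p = D * C := by
  have hC : C = ∏ p ∈ D.primeFactors, if p ∣ C then p else 1 := by
    rw [← Finset.prod_filter]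
    have : D.primeFactors.filter (· ∣ C) = C.primeFactors := by
      ext p
      simp only [Finset.mem_filter, Nat.mem_primeFactors]
      exact ⟨fun ⟨a, b⟩ => ⟨a.1, b, h.C_ne_zero⟩, fun a => ⟨⟨a.1, a.2.1.trans h.C_dvd, h.D_ne_zero⟩, a.2.1⟩⟩
    rw [this, Nat.prod_primeFactors_of_squarefree (h.squarefree.squarefree_of_dvd h.C_dvd)]
  have hD := (Nat.prod_primeFactors_of_squarefree h.squarefree).symm
  conv_rhs => rw [hC]; lhs; rw [hD]
  rw [← Finset.prod_mul_distrib]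
  refine Finset.prod_congr rfl fun p _ => ?_
  unfold levelExp
  split_ifs
  · rw [pow_two]
  · rw [pow_one, mul_one]

theorem prod_localGen (h : IsAdmissible D C M L f) :
    ∏ p ∈ (D / f).primeFactors, localGen M L C p =
      ((Nat.totient (D / f) : ℂ) * (muFun (L / f) : ℂ) * (Nat.gcd (D / M) C : ℂ)) /
        ((L / f : ℕ) : ℂ) := by
  have hd := h.squarefree_div
  have hLf : Squarefree (L / f) :=
    h.squarefree.squarefree_of_dvd ((Nat.div_dvd_of_dvd h.f_dvd_L).trans h.L_dvd)
  have hDM : Squarefree (D / M) := h.squarefree.squarefree_of_dvd (Nat.div_dvd_of_dvd h.M_dvd)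
  have hG : Squarefree (Nat.gcd (D / M) C) := hDM.squarefree_of_dvd (Nat.gcd_dvd_left _ _)
  have e1 : (Nat.totient (D / f) : ℂ) = ∏ p ∈ (D / f).primeFactors, ((p : ℂ) - 1) := by
    have h1 := Nat.totient_mul_prod_primeFactors (D / f)
    rw [Nat.prod_primeFactors_of_squarefree hd, mul_comm] at h1
    rw [Nat.eq_of_mul_eq_mul_left (Nat.pos_of_ne_zero hd.ne_zero) h1, Nat.cast_prod]
    refine Finset.prod_congr rfl fun p hp => ?_
    rw [Nat.cast_sub (Nat.prime_of_mem_primeFactors hp).one_le, Nat.cast_one]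
  have s2 : (D / f).primeFactors.filter (· ∣ L) = (L / f).primeFactors := by
    ext p
    rw [Finset.mem_filter, h.mem_iff, Nat.mem_primeFactors]
    constructor
    · rintro ⟨⟨hp, -, hpf⟩, hpL⟩
      refine ⟨hp, ?_, hLf.ne_zero⟩
      rw [← Nat.mul_div_cancel' h.f_dvd_L] at hpL
      exact ((Nat.Prime.dvd_mul hp).mp hpL).resolve_left hpf
    · rintro ⟨hp, hpL, -⟩
      have hpL' : p ∣ L := hpL.trans (Nat.div_dvd_of_dvd h.f_dvd_L)
      refine ⟨⟨hp, hpL'.trans h.L_dvd, fun hpf => ?_⟩, hpL'⟩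
      have h1 : p * p ∣ D := (mul_dvd_mul hpf hpL).trans
        (by rw [Nat.mul_div_cancel' h.f_dvd_L]; exact h.L_dvd)
      exact hp.one_lt.ne' (Nat.isUnit_iff.mp (h.squarefree p h1))
  have s3 : (D / f).primeFactors.filter (fun p => p ∣ C ∧ ¬ p ∣ M) =
      (Nat.gcd (D / M) C).primeFactors := by
    ext p
    rw [Finset.mem_filter, h.mem_iff, Nat.mem_primeFactors]
    constructor
    · rintro ⟨⟨hp, hpD, -⟩, hpC, hpM⟩
      refine ⟨hp, Nat.dvd_gcd ?_ hpC, hG.ne_zero⟩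
      rw [← Nat.mul_div_cancel' h.M_dvd] at hpD
      exact ((Nat.Prime.dvd_mul hp).mp hpD).resolve_left hpM
    · rintro ⟨hp, hpG, -⟩
      have hpDM : p ∣ D / M := hpG.trans (Nat.gcd_dvd_left _ _)
      have hpM : ¬ p ∣ M := fun hpM => by
        have h1 : p * p ∣ D := (mul_dvd_mul hpM hpDM).trans
          (by rw [Nat.mul_div_cancel' h.M_dvd])
        exact hp.one_lt.ne' (Nat.isUnit_iff.mp (h.squarefree p h1))
      exact ⟨⟨hp, hpDM.trans (Nat.div_dvd_of_dvd h.M_dvd), fun hpf => hpM (hpf.trans h.f_dvd_M)⟩,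
        hpG.trans (Nat.gcd_dvd_right _ _), hpM⟩
  have e2 : ∏ p ∈ (D / f).primeFactors, (if p ∣ L then ((p : ℂ) + 1) / p else 1) =
      (muFun (L / f) : ℂ) / ((L / f : ℕ) : ℂ) := by
    rw [← Finset.prod_filter, s2, Finset.prod_div_distrib, ← Nat.cast_prod,
      Nat.prod_primeFactors_of_squarefree hLf, muFun, Nat.cast_prod]
    push_cast
    rfl
  have e3 : ∏ p ∈ (D / f).primeFactors, (if p ∣ C ∧ ¬ p ∣ M then (p : ℂ) else 1) =
      (Nat.gcd (D / M) C : ℂ) := by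
    rw [← Finset.prod_filter, s3, ← Nat.cast_prod, Nat.prod_primeFactors_of_squarefree hG]
  unfold localGen
  rw [Finset.prod_mul_distrib, Finset.prod_mul_distrib, ← e1, e2, e3]
  ring

/-! ### Residues at a cusp -/

variable [NeZero f] {ψ : DirichletCharacter ℂ f}

theorem hasEulerValues (h : IsAdmissible D C M L f) (hprim : ψ.IsPrimitive)
    (hquad : ψ.IsQuadratic) :
    HasEulerValues ψ (D / f).primeFactors (eis M L ψ) (nPsi ψ) (localValue f M L) := by
  have aux : ∀ K, K ∣ D → f ∣ K → Squarefree (K / f) ∧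
      ∀ p ∈ (K / f).primeFactorsList, p ∈ (D / f).primeFactors := fun K hK hfK => by
    have hdvd : K / f ∣ D / f := Nat.div_dvd_div hfK hK
    exact ⟨h.squarefree_div.squarefree_of_dvd hdvd, fun p hp =>
      Nat.primeFactors_mono hdvd h.squarefree_div.ne_zero (List.mem_toFinset.mpr hp)⟩
  exact hasEulerValues_eis hprim hquad (fun q hq => ⟨(h.mem_iff.mp hq).1, h.coprime_of_mem hq⟩)
    (aux M h.M_dvd h.f_dvd_M).1 (aux L h.L_dvd h.f_dvd_L).1 (aux M h.M_dvd h.f_dvd_M).2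
    (aux L h.L_dvd h.f_dvd_L).2

theorem constTerm_eq (h : IsAdmissible D C M L f) (hprim : ψ.IsPrimitive)
    (hquad : ψ.IsQuadratic) (γ : SL(2, ℤ)) :
    constTerm (eis M L ψ) γ = nPsi ψ * (ψ (γ 0 0) * charQuot ψ (γ 1 0)) *
      ∏ p ∈ (D / f).primeFactors, localValue f M L p (emultiplicity (p : ℤ) (γ 1 0)) := by
  obtain ⟨κ, h1, -, h3⟩ := h.hasEulerValues hprim hquad
  have hdet := γ.det_coe
  rw [Matrix.det_fin_two] at hdet
  rw [h1.constTerm, h3 _ _ ⟨γ 1 1, -γ 0 1, by linear_combination hdet⟩]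

theorem local_factor (h : IsAdmissible D C M L f) (hp : p ∈ (D / f).primeFactors) (s : ℤ) :
    ((p ^ levelExp C p / Nat.gcd (s.natAbs ^ 2) (p ^ levelExp C p) : ℕ) : ℂ) *
        localValue f M L p (emultiplicity (p : ℤ) s) = localMult0 M L C p s * localGen M L C p ∧
      ((p ^ levelExp C p / Nat.gcd s.natAbs (p ^ levelExp C p) : ℕ) : ℂ) *
        localValue f M L p (emultiplicity (p : ℤ) s) = localMult1 M L C p s * localGen M L C p := by
  obtain ⟨hpp, hpD, -⟩ := h.mem_iff.mp hp
  rw [localValue_eq hpp (h.coprime_of_mem hp) h.M_ne_zero h.L_ne_zero h.f_dvd_M h.f_dvd_L]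
  exact QuadraticEisenstein.local_factor hpp (h.dvd_M_or_dvd_L hpp hpD) (h.dvd_C hpp) s

/-- A cusp with non-zero constant term has `s = ft` with `t` prime to `f`, so each `p ∣ f` divides
`s` exactly once. Such a `p` divides both `M` and `L`, hence `C`, and the level is `p²` there. The
local width is thus `1` for `Γ₀` and `p` for `Γ₁`, the source of the extra factor `f`. -/
theorem prod_width_primeFactors_conductor (h : IsAdmissible D C M L f) {s : ℤ}
    (hs : charQuot ψ s ≠ 0) :
    ∏ p ∈ f.primeFactors, p ^ levelExp C p / Nat.gcd (s.natAbs ^ 2) (p ^ levelExp C p) = 1 ∧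
      ∏ p ∈ f.primeFactors, p ^ levelExp C p / Nat.gcd s.natAbs (p ^ levelExp C p) = f := by
  obtain ⟨t, rfl, ht⟩ := exists_eq_mul_of_charQuot_ne_zero hs
  have hf : Squarefree f := h.squarefree.squarefree_of_dvd h.f_dvd_D
  have key : ∀ p ∈ f.primeFactors, p.Prime ∧ levelExp C p = 2 ∧ p ∣ (f * t).natAbs ∧
      ¬ p ^ 2 ∣ (f * t).natAbs := fun p hp => by
    have hpp := Nat.prime_of_mem_primeFactors hp
    have hpf := Nat.dvd_of_mem_primeFactors hp
    have hpC := h.dvd_C hpp (hpf.trans h.f_dvd_M) (hpf.trans h.f_dvd_L)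
    rw [Int.natAbs_mul, Int.natAbs_natCast]
    refine ⟨hpp, if_pos hpC, hpf.mul_right _, fun h2 => ?_⟩
    have hcop : Nat.Coprime (p ^ 2) t.natAbs := by
      have h3 : Nat.Coprime t.natAbs f := by
        have := Int.isCoprime_iff_gcd_eq_one.mp ht
        rwa [Int.gcd, Int.natAbs_natCast] at this
      exact ((h3.symm.coprime_dvd_left hpf).pow_left 2)
    have := hcop.dvd_of_dvd_mul_right h2
    rw [pow_two] at this
    exact hpp.one_lt.ne' (Nat.isUnit_iff.mp (hf p this))
  constructor
  · refine Finset.prod_eq_one fun p hp => ?_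
    obtain ⟨hpp, he, hd, -⟩ := key p hp
    rw [he, Nat.gcd_eq_right (pow_dvd_pow_of_dvd hd 2), Nat.div_self (pow_pos hpp.pos _)]
  · conv_rhs => rw [← Nat.prod_primeFactors_of_squarefree hf]
    refine Finset.prod_congr rfl fun p hp => ?_
    obtain ⟨hpp, he, hd, hd2⟩ := key p hp
    rw [he, gcd_prime_sq_of_dvd hpp hd hd2, pow_two, Nat.mul_div_cancel _ hpp.pos]

theorem residue_Gamma0 (h : IsAdmissible D C M L f) (hprim : ψ.IsPrimitive)
    (hquad : ψ.IsQuadratic) (γ : SL(2, ℤ)) :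
    (ramIndex (CongruenceSubgroup.Gamma0 (D * C)) γ : ℂ) * constTerm (eis M L ψ) γ =
      (ψ (γ 0 0) * charQuot ψ (γ 1 0)) *
        ((∏ p ∈ (D / f).primeFactors, localMult0 M L C p (γ 1 0) : ℤ) : ℂ) *
        (nPsi ψ * ∏ p ∈ (D / f).primeFactors, localGen M L C p) := by
  rw [h.constTerm_eq hprim hquad]
  by_cases hs : charQuot ψ (γ 1 0) = 0
  · simp [hs]
  rw [ramIndex_Gamma0 _ h.level_ne_zero, ← h.prod_levelExp,
    prod_div_gcd _ fun p hp => Nat.prime_of_mem_primeFactors hp, h.primeFactors_eq,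
    Finset.prod_union h.disjoint, (h.prod_width_primeFactors_conductor hs).1, one_mul, Nat.cast_prod,
    Int.cast_prod]
  have : ∀ A B X Y Z W : ℂ, A * B = Z * W → A * (X * Y * B) = Y * Z * (X * W) := fun A B X Y Z W e => by
    linear_combination X * Y * e
  refine this _ _ _ _ _ _ ?_
  rw [← Finset.prod_mul_distrib, ← Finset.prod_mul_distrib]
  exact Finset.prod_congr rfl fun p hp => (h.local_factor hp _).1

theorem residue_Gamma1 (h : IsAdmissible D C M L f) (hprim : ψ.IsPrimitive)
    (hquad : ψ.IsQuadratic) (h4 : D * C ≠ 4) (γ : SL(2, ℤ)) :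
    (ramIndex (CongruenceSubgroup.Gamma1 (D * C)) γ : ℂ) * constTerm (eis M L ψ) γ =
      (ψ (γ 0 0) * charQuot ψ (γ 1 0)) *
        ((∏ p ∈ (D / f).primeFactors, localMult1 M L C p (γ 1 0) : ℤ) : ℂ) *
        (nPsi ψ * ((∏ p ∈ (D / f).primeFactors, localGen M L C p) * f)) := by
  rw [h.constTerm_eq hprim hquad]
  by_cases hs : charQuot ψ (γ 1 0) = 0
  · simp [hs]
  rw [ramIndex_Gamma1 _ h.level_ne_zero h4, ← h.prod_levelExp,
    prod_div_gcd _ fun p hp => Nat.prime_of_mem_primeFactors hp, h.primeFactors_eq,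
    Finset.prod_union h.disjoint, (h.prod_width_primeFactors_conductor hs).2, Nat.cast_mul, Nat.cast_prod,
    Int.cast_prod]
  have : ∀ F A B X Y Z W : ℂ, A * B = Z * W → F * A * (X * Y * B) = Y * Z * (X * (W * F)) :=
    fun F A B X Y Z W e => by linear_combination F * X * Y * e
  refine this _ _ _ _ _ _ _ ?_
  rw [← Finset.prod_mul_distrib, ← Finset.prod_mul_distrib]
  exact Finset.prod_congr rfl fun p hp => (h.local_factor hp _).2

/-! ### The residue modules -/

theorem residueModule_Gamma0 (h : IsAdmissible D C M L f) (hprim : ψ.IsPrimitive)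
    (hquad : ψ.IsQuadratic) :
    residueModule (CongruenceSubgroup.Gamma0 (D * C)) (eis M L ψ) =
      Submodule.span ℤ {nPsi ψ * ∏ p ∈ (D / f).primeFactors, localGen M L C p} := by
  apply le_antisymm
  · rw [residueModule, Submodule.span_le]
    rintro _ ⟨γ, rfl⟩
    beta_reduce
    rw [h.residue_Gamma0 hprim hquad, SetLike.mem_coe, Submodule.mem_span_singleton]
    obtain ⟨k, hk⟩ := exists_int_eq_char_mul_charQuot hquad (γ 0 0) (γ 1 0)
    exact ⟨k * ∏ p ∈ (D / f).primeFactors, localMult0 M L C p (γ 1 0), by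
      rw [hk, zsmul_eq_mul, Int.cast_mul]⟩
  · rw [Submodule.span_singleton_le_iff_mem]
    have hS : ∀ q ∈ (D / f).primeFactors, q.Prime ∧ Nat.Coprime q f := fun q hq =>
      ⟨(h.mem_iff.mp hq).1, h.coprime_of_mem hq⟩
    -- Valuation `1` gives the multiple `-1` when `p` divides `M` and `C`; in all other cases
    -- valuation `0` gives `1`.
    let e : ℕ → ℕ := fun p => if p ∣ M ∧ p ∣ C then 1 else 0
    obtain ⟨γ, hs, hu⟩ := exists_cusp_char_mul_charQuot hquad (t := ∏ q ∈ (D / f).primeFactors, q ^ e q)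
      (Nat.Coprime.prod_left fun q hq => (hS q hq).2.pow_left _)
    have hval : ∏ p ∈ (D / f).primeFactors, localMult0 M L C p (γ 1 0) = 1 ∨
        ∏ p ∈ (D / f).primeFactors, localMult0 M L C p (γ 1 0) = -1 := by
      refine Finset.prod_induction _ (fun x => x = 1 ∨ x = -1) ?_ (Or.inl rfl) fun p hp => ?_
      · rintro a b (rfl | rfl) (rfl | rfl) <;> simp
      · have h1 := dvd_mul_prod_iff hS e hp 1
        have h2 := dvd_mul_prod_iff hS e hp 2
        rw [← hs] at h1 h2
        rw [pow_one] at h1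
        have hC := h.dvd_C (p := p) (hS p hp).1
        simp only [localMult0, h1, h2, e]
        by_cases hM : p ∣ M <;> by_cases hL : p ∣ L <;> by_cases hc : p ∣ C <;>
          simp_all
    have hmem : (ramIndex (CongruenceSubgroup.Gamma0 (D * C)) γ : ℂ) * constTerm (eis M L ψ) γ ∈
        residueModule (CongruenceSubgroup.Gamma0 (D * C)) (eis M L ψ) :=
      Submodule.subset_span ⟨γ, rfl⟩
    rw [h.residue_Gamma0 hprim hquad] at hmem
    rcases hu with hu | hu <;> rcases hval with hv | hv <;> rw [hu, hv] at hmem <;>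
      simpa using hmem

/-- At a prime dividing both `M` and `L` the attainable multiples are `p - 1`, `-p` and `0`, so no
single cusp need give a generator. Choosing valuation `0` or `1` independently at these primes and
summing over all choices yields the multiple `1`. -/
theorem residueModule_Gamma1_of_ne_four (h : IsAdmissible D C M L f) (hprim : ψ.IsPrimitive)
    (hquad : ψ.IsQuadratic) (h4 : D * C ≠ 4) :
    residueModule (CongruenceSubgroup.Gamma1 (D * C)) (eis M L ψ) =
      Submodule.span ℤ {nPsi ψ * ((∏ p ∈ (D / f).primeFactors, localGen M L C p) * f)} := by
  apply le_antisymm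
  · rw [residueModule, Submodule.span_le]
    rintro _ ⟨γ, rfl⟩
    beta_reduce
    rw [h.residue_Gamma1 hprim hquad h4, SetLike.mem_coe, Submodule.mem_span_singleton]
    obtain ⟨k, hk⟩ := exists_int_eq_char_mul_charQuot hquad (γ 0 0) (γ 1 0)
    exact ⟨k * ∏ p ∈ (D / f).primeFactors, localMult1 M L C p (γ 1 0), by
      rw [hk, zsmul_eq_mul, Int.cast_mul]⟩
  · rw [Submodule.span_singleton_le_iff_mem]
    set S := (D / f).primeFactors with hSdef
    set c := nPsi ψ * ((∏ p ∈ S, localGen M L C p) * f) with hc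
    have hS : ∀ q ∈ S, q.Prime ∧ Nat.Coprime q f := fun q hq =>
      ⟨(h.mem_iff.mp hq).1, h.coprime_of_mem hq⟩
    have hunit : ∀ T ⊆ S.filter (fun p => p ∣ M ∧ p ∣ L),
        ((((∏ p ∈ T, (p : ℤ)) * ∏ p ∈ S.filter (fun p => p ∣ M ∧ p ∣ L) \ T, (1 - (p : ℤ)) : ℤ) : ℂ) *
          c) ∈ residueModule (CongruenceSubgroup.Gamma1 (D * C)) (eis M L ψ) := by
      intro T hT
      -- Primes dividing `M` and `C` but not `L` need valuation `2`: valuations `0` and `1` would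
      -- give `±p`. Primes in `T` get valuation `1`, all others `0`.
      let e : ℕ → ℕ := fun p => if p ∣ M ∧ ¬ p ∣ L ∧ p ∣ C then 2 else if p ∈ T then 1 else 0
      obtain ⟨γ, hs, hu⟩ := exists_cusp_char_mul_charQuot hquad (t := ∏ q ∈ S, q ^ e q)
        (Nat.Coprime.prod_left fun q hq => (hS q hq).2.pow_left _)
      let m : ℕ → ℤ := fun p => if p ∣ M ∧ p ∣ L then if p ∈ T then p else 1 - p else 1
      have hm : (∏ p ∈ T, (p : ℤ)) * ∏ p ∈ S.filter (fun p => p ∣ M ∧ p ∣ L) \ T, (1 - (p : ℤ)) =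
          ∏ p ∈ S, m p := by
        rw [← Finset.prod_filter, ← Finset.prod_sdiff hT, mul_comm]
        congr 1
        · exact Finset.prod_congr rfl fun p hp => (if_neg (Finset.mem_sdiff.mp hp).2).symm
        · exact Finset.prod_congr rfl fun p hp => (if_pos hp).symm
      have hval : ∃ ε : ℕ → ℤ, (∀ p ∈ S, ε p = 1 ∨ ε p = -1) ∧
          ∀ p ∈ S, m p = ε p * localMult1 M L C p (γ 1 0) := by
        -- The signs turn `-p`, `p - 1` and `-1` into `p`, `1 - p` and `1`.
        refine ⟨fun p => if p ∣ M ∧ (p ∣ L ∨ p ∣ C) then -1 else 1, fun p _ => ?_, fun p hp => ?_⟩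
        · beta_reduce
          split_ifs <;> simp
        · have h1 := dvd_mul_prod_iff hS e hp 1
          have h2 := dvd_mul_prod_iff hS e hp 2
          rw [← hs] at h1 h2
          rw [pow_one] at h1
          have hC := h.dvd_C (p := p) (hS p hp).1
          have hML := h.dvd_M_or_dvd_L (p := p) (hS p hp).1 (h.mem_iff.mp hp).2.1
          have hTp : p ∈ T → p ∣ M ∧ p ∣ L := fun hpT => (Finset.mem_filter.mp (hT hpT)).2
          simp only [localMult1, h1, h2, e, m]
          by_cases hM : p ∣ M <;> by_cases hL : p ∣ L <;> by_cases hc : p ∣ C <;>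
            by_cases hpT : p ∈ T <;> simp_all
      obtain ⟨ε, hε, hmε⟩ := hval
      have hεp : ∏ p ∈ S, ε p = 1 ∨ ∏ p ∈ S, ε p = -1 := by
        refine Finset.prod_induction _ (fun x => x = 1 ∨ x = -1) ?_ (Or.inl rfl) hε
        rintro a b (rfl | rfl) (rfl | rfl) <;> simp
      have hmem : (ramIndex (CongruenceSubgroup.Gamma1 (D * C)) γ : ℂ) * constTerm (eis M L ψ) γ ∈
          residueModule (CongruenceSubgroup.Gamma1 (D * C)) (eis M L ψ) :=
        Submodule.subset_span ⟨γ, rfl⟩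
      rw [h.residue_Gamma1 hprim hquad h4, ← hSdef, ← hc] at hmem
      rw [hm, Finset.prod_congr rfl hmε, Finset.prod_mul_distrib]
      rcases hu with hu | hu <;> rcases hεp with hv | hv <;> rw [hv] <;> rw [hu] at hmem
      · simpa using hmem
      · simpa using neg_mem hmem
      · simpa using neg_mem hmem
      · simpa using hmem
    -- Expansion of `∏ (p + (1 - p))` over the subsets `T` of the primes dividing both `M` and `L`.
    have hone : (1 : ℤ) = ∑ T ∈ (S.filter (fun p => p ∣ M ∧ p ∣ L)).powerset,
        (∏ p ∈ T, (p : ℤ)) * ∏ p ∈ S.filter (fun p => p ∣ M ∧ p ∣ L) \ T, (1 - (p : ℤ)) := by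
      rw [← Finset.prod_add]
      exact (Finset.prod_eq_one fun p _ => by ring).symm
    have hc1 : c = ((1 : ℤ) : ℂ) * c := by simp
    rw [hc1, hone, Int.cast_sum, Finset.sum_mul]
    exact sum_mem fun T hT => hunit T (Finset.mem_powerset.mp hT)

/-- At level 4 the conductor is `1`: it is a square-free divisor of 4, and there is no primitive
character modulo 2. The widths for `Γ₁(4)` and `Γ₀(4)` agree, so the `Γ₀` result applies with `f =
1`. -/
theorem residueModule_Gamma1 (h : IsAdmissible D C M L f) (hprim : ψ.IsPrimitive)
    (hquad : ψ.IsQuadratic) :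
    residueModule (CongruenceSubgroup.Gamma1 (D * C)) (eis M L ψ) =
      Submodule.span ℤ {nPsi ψ * ((∏ p ∈ (D / f).primeFactors, localGen M L C p) * f)} := by
  by_cases h4 : D * C = 4
  · have hf : f = 1 := by
      by_contra hf
      have hp : f.minFac.Prime := Nat.minFac_prime hf
      have hD4 : D ∣ 4 := ⟨C, h4.symm⟩
      have hf2 : f ∣ 2 := by
        have : f ∣ 2 ^ 2 := h.f_dvd_D.trans hD4
        obtain ⟨k, hk, rfl⟩ := (Nat.dvd_prime_pow Nat.prime_two).mp this
        interval_cases k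
        · norm_num
        · norm_num
        · exact absurd (h.squarefree.squarefree_of_dvd h.f_dvd_D) (by
            intro hsq
            exact absurd (Nat.isUnit_iff.mp (hsq 2 (by norm_num))) (by norm_num))
      obtain rfl : f = 2 := ((Nat.dvd_prime Nat.prime_two).mp hf2).resolve_left hf
      refine ne_one_of_isPrimitive hprim hf (MulChar.ext fun u => ?_)
      have : u = 1 := Subsingleton.elim (h := ⟨by decide⟩) u 1
      rw [this]
      simp
    have heq : residueModule (CongruenceSubgroup.Gamma1 (D * C)) (eis M L ψ) =
        residueModule (CongruenceSubgroup.Gamma0 (D * C)) (eis M L ψ) := by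
      unfold residueModule
      simp_rw [h4, ramIndex_Gamma1_four]
    have hf1 : (f : ℂ) = 1 := by rw [hf, Nat.cast_one]
    rw [heq, h.residueModule_Gamma0 hprim hquad, hf1, mul_one]
  · exact h.residueModule_Gamma1_of_ne_four hprim hquad h4

end IsAdmissible

end QuadraticEisenstein

end

/-! ### Assembly of the three assertions -/

theorem corollary4 (D C M L f : ℕ) [NeZero f]
    (hD : Squarefree D) (hC : C ∣ D)
    (hM : M ∣ D) (hL : L ∣ D) (hM1 : M ≠ 1) (hDML : D ∣ M * L) (hMLDC : M * L ∣ D * C)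
    (ψ : DirichletCharacter ℂ f) (hprim : ψ.IsPrimitive) (hf : f ∣ Nat.gcd M L)
    (hquad : ψ.IsQuadratic) :
    (∃ F : ModularForm (CongruenceSubgroup.Gamma0 (D * C) : Subgroup (GL (Fin 2) ℝ)) 2,
      (F : UpperHalfPlane → ℂ) = QuadraticEisenstein.eis M L ψ) ∧
    QuadraticEisenstein.residueModule (CongruenceSubgroup.Gamma0 (D * C))
        (QuadraticEisenstein.eis M L ψ) =
      Submodule.span ℤ {QuadraticEisenstein.nPsi ψ *
        (((Nat.totient (D / f) : ℂ) * (QuadraticEisenstein.muFun (L / f) : ℂ) *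
          (Nat.gcd (D / M) C : ℂ)) / ((L / f : ℕ) : ℂ))} ∧
    QuadraticEisenstein.residueModule (CongruenceSubgroup.Gamma1 (D * C))
        (QuadraticEisenstein.eis M L ψ) =
      Submodule.span ℤ {QuadraticEisenstein.nPsi ψ *
        (((Nat.totient (D / f) : ℂ) * (QuadraticEisenstein.muFun (L / f) : ℂ) *
          (Nat.gcd (D / M) C : ℂ) * (f : ℂ)) / ((L / f : ℕ) : ℂ))} := by
  have h : QuadraticEisenstein.IsAdmissible D C M L f := ⟨hD, hC, hM, hL, hDML, hMLDC,
    hf.trans (Nat.gcd_dvd_left _ _), hf.trans (Nat.gcd_dvd_right _ _)⟩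
  have : NeZero (D * C) := ⟨h.level_ne_zero⟩
  refine ⟨QuadraticEisenstein.exists_modularForm_eq_eis hprim hquad h.M_ne_zero h.L_ne_zero hM1
    h.f_dvd_M h.f_dvd_L hMLDC (h.hasEulerValues hprim hquad), ?_, ?_⟩
  · rw [h.residueModule_Gamma0 hprim hquad, h.prod_localGen]
  · rw [h.residueModule_Gamma1 hprim hquad, h.prod_localGen, div_mul_eq_mul_div]
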